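/- Let $d, D$ be non-negative integers with $D\ge d$ and $D\neq d+1$, let $V\in\mathbb{R}^{d\times d}$ be symmetric positive definite, and let $\Sigma\sim\mathcal{W}_d(D;V)$ be Wishart, i.e. $\Sigma=GG^{\top}$ where the $D$ columns of $G\in\mathbb{R}^{d\times D}$ are i.i.d. $\mathcal{N}(0,V)$ vectors (so that $\Sigma$ is almost surely positive definite). Let $g$ be a function from the symmetric positive definite $d\times d$ matrices to $\mathbb{R}^{d\times d}$ that is differentiable (with respect to symmetric matrices). Define the symmetric divergence of $g$ by $$\langle \mathbf{D}_\Sigma, g(\Sigma)\rangle=\sum_{i,j=1}^d \frac{1+\mathbf 1[i=j]}{2}\,\frac{\partial}{\partial\Sigma_{ij}}\, g(\Sigma)_{ij},$$ where $\Sigma_{ij}$ and $\Sigma_{ji}$ are identified when differentiating (functions of $\Sigma$ are seen as functions of its lower triangular entries), and assume that $\mathbb{E}\,|\langle \mathbf{D}_\Sigma, g(\Sigma)\rangle|<\infty$. Then $$\mathbb{E}\,\langle \mathbf{D}_\Sigma, g(\Sigma)\rangle\;\ge\;\frac{d(d+1)}{2}-\frac12\sqrt{\mathbb{E}\,\|\Sigma-g(\Sigma)\|_F^2}\cdot\sqrt{\mathbb{E}\,\|(D-d-1)\Sigma^{-1}-V^{-1}\|_F^2},$$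 where the two expectations on the right are taken in $[0,\infty]$ (with $0\cdot\infty=0$; the bound is void if the product is infinite). In particular, if $d\ge 5$, $D=2d$ and $V=\frac1D I$, then $$\mathbb{E}\,\langle \mathbf{D}_\Sigma, g(\Sigma)\rangle\;\ge\;\frac{d(d+1)}{2}-2d^{3/2}\sqrt{\mathbb{E}\,\|\Sigma-g(\Sigma)\|_F^2}.$$ -/

import Mathlib

open scoped Matrix ENNReal Matrix.Norms.Frobenius

namespace WishartDivergence

/-- Real matrices carry the product (that is, Borel) sigma-algebra of their entries. -/
instance measurableSpaceMatrix (m n : ℕ) : MeasurableSpace (Matrix (Fin m) (Fin n) ℝ) :=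
  inferInstanceAs (MeasurableSpace (Fin m → Fin n → ℝ))

instance borelSpaceMatrix (m n : ℕ) : BorelSpace (Matrix (Fin m) (Fin n) ℝ) :=
  inferInstanceAs (BorelSpace (Fin m → Fin n → ℝ))

/-- The `d × D` matrix whose columns are the vectors `x 0, …, x (D - 1)`. -/
def colMatrix {d D : ℕ} (x : Fin D → EuclideanSpace ℝ (Fin d)) : Matrix (Fin d) (Fin D) ℝ :=
  Matrix.of fun i k => x k i

/-- The Wishart distribution `W_d(D; V)`: the law of `G * Gᵀ`, where the `D` columns of the
`d × D` matrix `G` are independent `N(0, V)` vectors. -/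
noncomputable def wishart (d D : ℕ) (V : Matrix (Fin d) (Fin d) ℝ) :
    MeasureTheory.Measure (Matrix (Fin d) (Fin d) ℝ) :=
  (MeasureTheory.Measure.pi fun _ : Fin D => ProbabilityTheory.multivariateGaussian 0 V).map
    fun x => colMatrix x * (colMatrix x)ᵀ

theorem measurable_gram (d D : ℕ) :
    Measurable fun x : Fin D → EuclideanSpace ℝ (Fin d) => colMatrix x * (colMatrix x)ᵀ := by
  refine measurable_pi_iff.2 fun i => measurable_pi_iff.2 fun j => ?_
  simp only [Matrix.mul_apply, colMatrix, Matrix.transpose_apply, Matrix.of_apply]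
  fun_prop

instance isProbabilityMeasure_wishart (d D : ℕ) (V : Matrix (Fin d) (Fin d) ℝ) :
    MeasureTheory.IsProbabilityMeasure (wishart d D V) :=
  MeasureTheory.Measure.isProbabilityMeasure_map (measurable_gram d D).aemeasurable

/-- The symmetric matrix with entries `1` at the positions `(i, j)` and `(j, i)` and `0`
elsewhere. -/
def symUnit {d : ℕ} (i j : Fin d) : Matrix (Fin d) (Fin d) ℝ :=
  Matrix.of fun k l => if (k = i ∧ l = j) ∨ (k = j ∧ l = i) then 1 else 0

/-- The partial derivative `∂f / ∂Σ_{ij}` at `S` of a function of a symmetric matrix, where the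
entries `Σ_{ij}` and `Σ_{ji}` are identified (`f` is seen as a function of the lower triangular
entries): both entries are moved together. -/
noncomputable def symPartial {d : ℕ} (f : Matrix (Fin d) (Fin d) ℝ → ℝ)
    (S : Matrix (Fin d) (Fin d) ℝ) (i j : Fin d) : ℝ :=
  deriv (fun t : ℝ => f (S + t • symUnit i j)) 0

/-- The symmetric divergence `⟨D_Σ, g(Σ)⟩ = ∑_{i,j} D_Σ(i,j) g_{ij}` at `S`, where
`D_Σ(i,j) = (1 + 𝟙[i = j]) / 2 · ∂ / ∂Σ_{ij}`. -/
noncomputable def symDiv {d : ℕ} (g : Matrix (Fin d) (Fin d) ℝ → Matrix (Fin d) (Fin d) ℝ)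
    (S : Matrix (Fin d) (Fin d) ℝ) : ℝ :=
  ∑ i, ∑ j, ((1 + if i = j then 1 else 0) / 2) * symPartial (fun A => g A i j) S i j

/-- The expected squared Frobenius norm `E ‖X(Σ)‖_F²` for `Σ` with law `μ`, in `[0, ∞]`. -/
noncomputable def expSqFrob {d : ℕ} (μ : MeasureTheory.Measure (Matrix (Fin d) (Fin d) ℝ))
    (X : Matrix (Fin d) (Fin d) ℝ → Matrix (Fin d) (Fin d) ℝ) : ℝ≥0∞ :=
  ∫⁻ S, ENNReal.ofReal (‖X S‖ ^ 2) ∂μ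

end WishartDivergence

/-! The bound is Stein's identity for the Wishart law followed by Cauchy–Schwarz. Write Σ =
(AZ)(AZ)ᵀ with A Aᵀ = V and Z a d × D matrix of independent standard Gaussians. For a matrix field h
on the positive definite cone, put F(Z) = A⁻¹ h(Σ) Σ⁻¹ A Z (`steinField`). Then div F − ⟨Z, F⟩ =
2⟨D_Σ, h⟩ + tr(h(Σ) U) with U = (D−d−1)Σ⁻¹ − V⁻¹, and Gaussian integration by parts makes its mean
zero (`integral_steinOp_eq_zero`). For h = g − id, since ⟨D_Σ, id⟩ = d(d+1)/2, this reads E⟨D_Σ, g⟩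
= d(d+1)/2 − ½ E tr((g(Σ) − Σ) U), and Cauchy–Schwarz finishes (`ofReal_sub_integral_symDiv_le`).

Regularity is the delicate point: g is differentiable on the cone only, its derivative need not be
continuous, and only ⟨D_Σ, g⟩ is assumed integrable. The divergence theorem is therefore used in a
form that needs only pointwise differentiability and an integrable divergence, for fields cut off to
bounded trace and to determinant bounded below. The cutoff is then removed by dominated convergence:
its derivative in the log-determinant direction stays bounded, and its derivative in the trace
direction tends to zero.

The explicit case needs E tr Σ⁻¹ and E‖Σ⁻¹‖². Both are bounded by the same identity with h = I and h
= (D−d−1)Σ⁻¹ + tr(Σ⁻¹) I. There integrability is not known beforehand, so a one-sided version with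
Fatou's lemma is used (`integrable_and_integral_le_of_steinOp`). -/

namespace WishartDivergence

open MeasureTheory ProbabilityTheory Filter Topology

/-! ### Gaussian integration by parts for compactly supported fields. -/

section Gaussian

variable {ι : Type*} [Fintype ι]

/-- The standard Gaussian measure on `ι → ℝ`. -/
noncomputable abbrev stdGauss (ι : Type*) [Fintype ι] : Measure (ι → ℝ) :=
  Measure.pi fun _ : ι => gaussianReal 0 1

/-- The density of `stdGauss ι`. -/
noncomputable def gaussDensity (z : ι → ℝ) : ℝ := ∏ i, gaussianPDFReal 0 1 (z i)

theorem gaussDensity_pos (z : ι → ℝ) : 0 < gaussDensity z :=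
  Finset.prod_pos fun i _ => gaussianPDFReal_pos 0 1 (z i) one_ne_zero

theorem hasDerivAt_gaussianPDFReal (x : ℝ) :
    HasDerivAt (gaussianPDFReal 0 1) (-x * gaussianPDFReal 0 1 x) x := by
  have h : HasDerivAt (fun y : ℝ => (√(2 * Real.pi * (1 : NNReal)))⁻¹ *
      Real.exp (-(y - 0) ^ 2 / (2 * (1 : NNReal)))) _ x :=
    ((((((hasDerivAt_id x).sub_const 0).pow 2).neg).div_const
      (2 * ((1 : NNReal) : ℝ))).exp).const_mul _
  convert! h using 1
  simp [gaussianPDFReal]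
  ring

theorem hasFDerivAt_gaussianPDFReal_apply (z : ι → ℝ) (i : ι) :
    HasFDerivAt (fun z : ι → ℝ => gaussianPDFReal 0 1 (z i))
      ((-z i * gaussianPDFReal 0 1 (z i)) • (ContinuousLinearMap.proj i : (ι → ℝ) →L[ℝ] ℝ)) z :=
  HasDerivAt.comp_hasFDerivAt (h₂ := gaussianPDFReal 0 1) (f := fun z : ι → ℝ => z i) z
    (hasDerivAt_gaussianPDFReal (z i)) (hasFDerivAt_apply i z)

theorem hasFDerivAt_gaussDensity (z : ι → ℝ) :
    ∃ p' : (ι → ℝ) →L[ℝ] ℝ, HasFDerivAt gaussDensity p' z ∧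
      ∀ v, p' v = -(∑ i, z i * v i) * gaussDensity z := by
  classical
  have h : HasFDerivAt (fun z : ι → ℝ => ∏ i, gaussianPDFReal 0 1 (z i)) _ z :=
    HasFDerivAt.finsetProd fun i _ => hasFDerivAt_gaussianPDFReal_apply z i
  refine ⟨_, h, fun v => ?_⟩
  simp only [sum_apply, smul_apply, smul_eq_mul,
    ContinuousLinearMap.proj_apply, gaussDensity]
  rw [neg_mul, Finset.sum_mul, ← Finset.sum_neg_distrib]
  refine Finset.sum_congr rfl fun i hi => ?_
  rw [← Finset.mul_prod_erase _ _ hi]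
  ring

theorem continuous_gaussDensity : Continuous (gaussDensity : (ι → ℝ) → ℝ) :=
  continuous_iff_continuousAt.2 fun z => (hasFDerivAt_gaussDensity z).choose_spec.1.continuousAt

theorem stdGauss_eq_withDensity :
    stdGauss ι = (volume : Measure (ι → ℝ)).withDensity
      fun z => ENNReal.ofReal (gaussDensity z) := by
  refine Measure.pi_eq fun s hs => ?_
  rw [withDensity_apply _ (MeasurableSet.univ_pi hs), volume_pi, Measure.restrict_pi_pi]
  have hint : ∀ i, Integrable (gaussianPDFReal 0 1) (volume.restrict (s i)) := fun i =>
    (integrable_gaussianPDFReal 0 1).integrableOn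
  have h := integral_fintype_prod_eq_prod (μ := fun i => (volume : Measure ℝ).restrict (s i))
    (fun _ => gaussianPDFReal 0 1)
  simp only [gaussDensity]
  rw [← ofReal_integral_eq_lintegral_ofReal (Integrable.fintype_prod hint)
    (ae_of_all _ fun z => (gaussDensity_pos z).le)]
  rw [h, ENNReal.ofReal_prod_of_nonneg fun i _ =>
    integral_nonneg fun x => gaussianPDFReal_nonneg _ _ _]
  exact Finset.prod_congr rfl fun i _ => (gaussianReal_apply_eq_integral 0 one_ne_zero _).symm

/-- The divergence theorem on a cube containing the support: all face integrals vanish. Continuity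
of the derivative is not needed, which is what allows a merely differentiable `g`. The index type is
moved to `Fin (n + 1)`, where the faces are parametrised by `insertNth`. -/
theorem integral_div_eq_zero [Nonempty ι] [DecidableEq ι] (F : (ι → ℝ) → ι → ℝ)
    (F' : (ι → ℝ) → (ι → ℝ) →L[ℝ] (ι → ℝ)) (hF : ∀ z, HasFDerivAt F (F' z) z)
    (hc : HasCompactSupport F)
    (hi : Integrable fun z => ∑ i, F' z (Pi.single i 1) i) :
    ∫ z, ∑ i, F' z (Pi.single i 1) i = 0 := by
  obtain ⟨n, hn⟩ : ∃ n, Fintype.card ι = n + 1 :=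
    ⟨Fintype.card ι - 1, (Nat.succ_pred_eq_of_pos Fintype.card_pos).symm⟩
  let e : ι ≃ Fin (n + 1) := Fintype.equivFinOfCardEq hn
  -- The support lies in an open ball, so `F` vanishes already at norm exactly `R`, hence on the
  -- faces of the cube.
  obtain ⟨R, hR0, hR⟩ : ∃ R : ℝ, 0 < R ∧ ∀ z, R ≤ ‖z‖ → F z = 0 := by
    obtain ⟨R, hR⟩ := hc.isBounded.subset_ball_lt 0 0
    refine ⟨R, hR.1, fun z hz => ?_⟩
    by_contra h
    have := hR.2 (subset_tsupport _ h)
    rw [mem_ball_zero_iff] at this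
    linarith
  have hF'0 : ∀ z, R < ‖z‖ → F' z = 0 := fun z hz => by
    refine (hF z).unique ((hasFDerivAt_const (0 : ι → ℝ) z).congr_of_eventuallyEq ?_)
    filter_upwards [(isOpen_lt continuous_const continuous_norm).mem_nhds hz] with y hy
    exact hR y (le_of_lt hy)
  let eL : (ι → ℝ) ≃L[ℝ] (Fin (n + 1) → ℝ) := ContinuousLinearEquiv.piCongrLeft ℝ (fun _ => ℝ) e
  have heL : ∀ z j, eL z j = z (e.symm j) := fun z j => by
    simp [eL, ContinuousLinearEquiv.piCongrLeft, Equiv.piCongrLeft, Equiv.piCongrLeft']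
  have heLs : ∀ z i, eL.symm z i = z (e i) := fun z i => by
    have := heL (eL.symm z) (e i)
    simpa using this.symm
  have hsingle : ∀ j, eL.symm (Pi.single j 1) = Pi.single (e.symm j) 1 := fun j => by
    ext i
    rw [heLs]
    simp only [Pi.single_apply, Equiv.eq_symm_apply]
  have hbig : ∀ z : ι → ℝ, z ∉ Set.Icc (fun _ => -R) (fun _ => R) → R < ‖z‖ := fun z hz => by
    by_contra h
    push Not at h
    exact hz ⟨fun i => (abs_le.1 ((norm_le_pi_norm z i).trans h)).1,
      fun i => (abs_le.1 ((norm_le_pi_norm z i).trans h)).2⟩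
  have hvol : MeasurePreserving eL volume volume := by
    have h := volume_measurePreserving_piCongrLeft (fun _ : Fin (n + 1) => ℝ) e
    have h2 : (eL : (ι → ℝ) → Fin (n + 1) → ℝ) =
        MeasurableEquiv.piCongrLeft (fun _ : Fin (n + 1) => ℝ) e := by
      ext z j
      obtain ⟨i, rfl⟩ := e.surjective j
      rw [heL, MeasurableEquiv.coe_piCongrLeft, Equiv.piCongrLeft_apply_apply, e.symm_apply_apply]
    rwa [h2]
  have key := integral_divergence_of_hasFDerivAt_off_countable_of_equiv (E := ℝ) (F := ι → ℝ) eL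
    (fun x y => ⟨fun h i => by simpa [heL] using h (e i), fun h j => by simpa [heL] using h _⟩)
    hvol
    (fun j z => F z (e.symm j)) (fun j z => (ContinuousLinearMap.proj (e.symm j)).comp (F' z))
    ∅ Set.countable_empty (fun _ => -R) (fun _ => R) (fun i => by simp; linarith)
    (fun j z _ => (hasFDerivAt_pi'.1 (hF z) (e.symm j)).continuousAt.continuousWithinAt)
    (fun z _ j => hasFDerivAt_pi'.1 (hF z) (e.symm j))
    (fun z => ∑ i, F' z (Pi.single i 1) i)
    (fun z => by simp [hsingle, Equiv.sum_comp e.symm fun i => F' z (Pi.single i 1) i])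
    hi.integrableOn
  rw [setIntegral_eq_integral_of_forall_compl_eq_zero fun z hz => by simp [hF'0 z (hbig z hz)]]
    at key
  rw [key]
  refine Finset.sum_eq_zero fun j _ => ?_
  have hface : ∀ (r : ℝ) x, |r| = R → F (eL.symm (j.insertNth r x)) = 0 := fun r x hr => by
    refine hR _ ?_
    refine le_trans ?_ (norm_le_pi_norm _ (e.symm j))
    simp [heLs, hr]
  simp only [heL]
  simp [hface _ _ (abs_of_pos hR0), hface (-R) _ (by rw [abs_neg, abs_of_pos hR0])]

/-- With φ the Gaussian density, ∇φ = −zφ, so div(φF) = φ(div F − ⟨z, F⟩), and φF is again compactly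
supported. -/
theorem integral_stein_stdGauss [Nonempty ι] [DecidableEq ι] (F : (ι → ℝ) → ι → ℝ)
    (F' : (ι → ℝ) → (ι → ℝ) →L[ℝ] (ι → ℝ)) (hF : ∀ z, HasFDerivAt F (F' z) z)
    (hc : HasCompactSupport F)
    (hi : Integrable (fun z => ∑ i, F' z (Pi.single i 1) i - ∑ i, z i * F z i) (stdGauss ι)) :
    ∫ z, (∑ i, F' z (Pi.single i 1) i - ∑ i, z i * F z i) ∂stdGauss ι = 0 := by
  have hm : Measurable fun z : ι → ℝ => ENNReal.ofReal (gaussDensity z) :=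
    continuous_gaussDensity.measurable.ennreal_ofReal
  choose p' hp' hpv using hasFDerivAt_gaussDensity (ι := ι)
  have hd : ∀ z, ∑ i, (gaussDensity z • F' z + (p' z).smulRight (F z)) (Pi.single i 1) i =
      (ENNReal.ofReal (gaussDensity z)).toReal •
        (∑ i, F' z (Pi.single i 1) i - ∑ i, z i * F z i) := fun z => by
    rw [ENNReal.toReal_ofReal (gaussDensity_pos z).le, smul_eq_mul, mul_sub, Finset.mul_sum,
      Finset.mul_sum, ← Finset.sum_sub_distrib]
    refine Finset.sum_congr rfl fun i _ => ?_
    simp [hpv, Pi.single_apply]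
    ring
  have hlt : ∀ᵐ z : ι → ℝ, ENNReal.ofReal (gaussDensity z) < ∞ :=
    ae_of_all _ fun _ => ENNReal.ofReal_lt_top
  rw [stdGauss_eq_withDensity, integrable_withDensity_iff_integrable_smul' hm hlt] at hi
  rw [stdGauss_eq_withDensity, integral_withDensity_eq_integral_toReal_smul hm hlt]
  simp only [← hd] at hi ⊢
  have hG : ∀ z, HasFDerivAt (fun z => gaussDensity z • F z)
      (gaussDensity z • F' z + (p' z).smulRight (F z)) z := fun z => (hp' z).smul (hF z)
  have hc' : HasCompactSupport fun z => gaussDensity z • F z := hc.mono fun z hz h => hz <| by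
    show gaussDensity z • F z = 0
    rw [h, smul_zero]
  exact integral_div_eq_zero _ _ hG hc' hi

end Gaussian

/-! ### Matrix calculus and the symmetric divergence as a Fréchet derivative. -/

section Calculus

theorem exists_hasFDerivAt_matrix_mul {E : Type*} [NormedAddCommGroup E] [NormedSpace ℝ E]
    {l m n : ℕ} {f : E → Matrix (Fin l) (Fin m) ℝ} {g : E → Matrix (Fin m) (Fin n) ℝ}
    {f' : E →L[ℝ] Matrix (Fin l) (Fin m) ℝ} {g' : E →L[ℝ] Matrix (Fin m) (Fin n) ℝ} {z : E}
    (hf : HasFDerivAt f f' z) (hg : HasFDerivAt g g' z) :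
    ∃ L : E →L[ℝ] Matrix (Fin l) (Fin n) ℝ, HasFDerivAt (fun y => f y * g y) L z ∧
      ∀ v, L v = f' v * g z + f z * g' v := by
  let B : Matrix (Fin l) (Fin m) ℝ →ₗ[ℝ] Matrix (Fin m) (Fin n) ℝ →ₗ[ℝ] Matrix (Fin l) (Fin n) ℝ :=
    LinearMap.mk₂ ℝ (fun P Q => P * Q) Matrix.add_mul Matrix.smul_mul Matrix.mul_add
      (fun c P Q => Matrix.mul_smul P c Q)
  refine ⟨_, B.toContinuousBilinearMap.hasFDerivAt_of_bilinear hf hg, fun v => ?_⟩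
  exact add_comm (f z * g' v) (f' v * g z)

variable {d : ℕ}

theorem exists_hasFDerivAt_matrix_inv {S : Matrix (Fin d) (Fin d) ℝ} (hS : IsUnit S) :
    ∃ L : Matrix (Fin d) (Fin d) ℝ →L[ℝ] Matrix (Fin d) (Fin d) ℝ,
      HasFDerivAt (fun A : Matrix (Fin d) (Fin d) ℝ => A⁻¹) L S ∧ ∀ E, L E = -(S⁻¹ * E * S⁻¹) := by
  obtain ⟨u, rfl⟩ := hS
  have h := hasFDerivAt_ringInverse (𝕜 := ℝ) u
  have h2 : (fun A : Matrix (Fin d) (Fin d) ℝ => A⁻¹) = Ring.inverse := by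
    ext1 A
    exact Matrix.nonsing_inv_eq_ringInverse A
  rw [h2]
  refine ⟨_, h, fun E => ?_⟩
  rw [← Matrix.coe_units_inv]
  rfl

theorem hasDerivAt_line (S E : Matrix (Fin d) (Fin d) ℝ) :
    HasDerivAt (fun t : ℝ => S + t • E) E 0 := by
  have h := ((hasDerivAt_id (0 : ℝ)).smul_const E).const_add S
  rw [one_smul] at h
  exact h

theorem differentiable_det : Differentiable ℝ fun A : Matrix (Fin d) (Fin d) ℝ => A.det := by
  have h : ∀ i j, Differentiable ℝ fun A : Matrix (Fin d) (Fin d) ℝ => A i j := fun i j =>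
    (LinearMap.toContinuousLinearMap (Matrix.entryLinearMap ℝ ℝ i j)).differentiable
  have hdet : (fun A : Matrix (Fin d) (Fin d) ℝ => A.det) = fun A =>
      ∑ σ : Equiv.Perm (Fin d), ((Equiv.Perm.sign σ : ℤ) : ℝ) * ∏ i, A (σ i) i :=
    funext fun A => Matrix.det_apply' A
  rw [hdet]
  have hprod : ∀ σ : Equiv.Perm (Fin d),
      Differentiable ℝ fun A : Matrix (Fin d) (Fin d) ℝ => ∏ i, A (σ i) i := fun σ A =>
    (HasFDerivAt.finsetProd (u := Finset.univ) fun i _ =>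
      (h (σ i) i A).hasFDerivAt).differentiableAt
  exact Differentiable.fun_sum fun σ _ => (hprod σ).const_mul _

theorem hasDerivAt_det_one_add (M : Matrix (Fin d) (Fin d) ℝ) :
    HasDerivAt (fun t : ℝ => (1 + t • M).det) M.trace 0 := by
  have h := ((1 + (Polynomial.X : Polynomial ℝ) • M.map Polynomial.C).det).hasDerivAt 0
  rw [Matrix.derivative_det_one_add_X_smul] at h
  convert! h using 1
  ext t
  rw [← Polynomial.coe_evalRingHom, RingHom.map_det]
  congr 1
  ext i j
  simp only [Matrix.one_apply, RingHom.mapMatrix_apply, Matrix.map_apply, Matrix.add_apply,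
    Matrix.smul_apply, smul_eq_mul, Polynomial.coe_evalRingHom, Polynomial.eval_add,
    Polynomial.eval_mul, Polynomial.eval_X, Polynomial.eval_C]
  split_ifs <;> simp

/-- Jacobi's formula, from det(S + tE) = det S · det(1 + t S⁻¹E). -/
theorem hasFDerivAt_det {S : Matrix (Fin d) (Fin d) ℝ} (hS : IsUnit S) :
    ∃ L : Matrix (Fin d) (Fin d) ℝ →L[ℝ] ℝ,
      HasFDerivAt (fun A : Matrix (Fin d) (Fin d) ℝ => A.det) L S ∧
        ∀ E, L E = S.det * (S⁻¹ * E).trace := by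
  have h := (differentiable_det S).hasFDerivAt
  refine ⟨_, h, fun E => ?_⟩
  have h1 : HasDerivAt (fun t : ℝ => (S + t • E).det) _ 0 :=
    HasFDerivAt.comp_hasDerivAt_of_eq (f := fun t : ℝ => S + t • E) 0 h (hasDerivAt_line S E)
      (by rw [zero_smul, add_zero])
  have h2 := (hasDerivAt_det_one_add (S⁻¹ * E)).const_mul S.det
  have h3 : (fun t : ℝ => S.det * (1 + t • (S⁻¹ * E)).det) = fun t => (S + t • E).det := by
    ext t
    rw [← Matrix.det_mul, mul_add, mul_one, mul_smul_comm, ← mul_assoc,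
      Matrix.mul_nonsing_inv _ ((Matrix.isUnit_iff_isUnit_det S).1 hS), one_mul]
  rw [h3] at h2
  exact h1.unique h2

/-- The cone is open only among Hermitian matrices. Positivity of the quadratic form on the compact
unit sphere survives small perturbations. This turns derivatives within the cone into ordinary
derivatives along symmetric lines and along Gram matrices. -/
theorem posDef_mem_nhdsWithin {S : Matrix (Fin d) (Fin d) ℝ} (hS : S.PosDef) :
    {A : Matrix (Fin d) (Fin d) ℝ | A.PosDef} ∈ 𝓝[{A | A.IsHermitian}] S := by
  have hc : IsCompact (Metric.sphere (0 : Fin d → ℝ) 1) := isCompact_sphere _ _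
  have hcont : Continuous fun p : Matrix (Fin d) (Fin d) ℝ × (Fin d → ℝ) => p.2 ⬝ᵥ p.1 *ᵥ p.2 := by
    fun_prop
  have key : ∀ᶠ A in 𝓝 S, ∀ x ∈ Metric.sphere (0 : Fin d → ℝ) 1, 0 < x ⬝ᵥ A *ᵥ x := by
    refine hc.eventually_forall_of_forall_eventually fun x hx => ?_
    refine hcont.continuousAt.eventually (lt_mem_nhds ?_)
    exact hS.dotProduct_mulVec_pos (by rintro rfl; simp at hx)
  filter_upwards [nhdsWithin_le_nhds key, self_mem_nhdsWithin] with A hA hAh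
  refine Matrix.PosDef.of_dotProduct_mulVec_pos hAh fun x hx => ?_
  have hn : 0 < ‖x‖ := norm_pos_iff.2 hx
  have := hA (‖x‖⁻¹ • x) (by simp [norm_smul, hn.ne'])
  rw [Matrix.mulVec_smul, dotProduct_smul, smul_dotProduct, smul_eq_mul, smul_eq_mul] at this
  simp only [star_trivial]
  have h2 : 0 < ‖x‖⁻¹ := by positivity
  exact (mul_pos_iff_of_pos_left h2).1 ((mul_pos_iff_of_pos_left h2).1 this)

theorem isClosed_posSemidef : IsClosed {A : Matrix (Fin d) (Fin d) ℝ | A.PosSemidef} := by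
  simp only [Matrix.posSemidef_iff_dotProduct_mulVec, Set.ofPred_and, Set.ofPred_forall]
  refine IsClosed.inter ?_ (isClosed_iInter fun x => isClosed_le continuous_const (by fun_prop))
  exact isClosed_eq (by fun_prop) continuous_id

theorem measurableSet_posDef : MeasurableSet {A : Matrix (Fin d) (Fin d) ℝ | A.PosDef} := by
  have : {A : Matrix (Fin d) (Fin d) ℝ | A.PosDef} =
      {A | A.PosSemidef} ∩ {A | A.det ≠ 0} := by
    ext A
    exact ⟨fun h => ⟨h.posSemidef, h.det_pos.ne'⟩, fun h => h.1.posDef_iff_det_ne_zero.2 h.2⟩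
  rw [this]
  exact isClosed_posSemidef.measurableSet.inter
    (isOpen_ne_fun differentiable_det.continuous continuous_const).measurableSet

theorem isHermitian_symUnit (i j : Fin d) : (symUnit i j).IsHermitian := by
  ext k l
  simp only [symUnit, Matrix.conjTranspose_apply, Matrix.of_apply, star_trivial]
  congr 1
  apply propext
  tauto

/-- The weight in the symmetric divergence serves exactly to treat diagonal and off-diagonal
directions alike, as half of E_ij + E_ji. -/
theorem symUnit_weight (i j : Fin d) : ((1 + if i = j then (1 : ℝ) else 0) / 2) • symUnit i j =
    (1 / 2 : ℝ) • (Matrix.single i j (1 : ℝ) + Matrix.single j i 1) := by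
  ext k l
  simp only [symUnit, Matrix.smul_apply, Matrix.of_apply, Matrix.add_apply, Matrix.single_apply,
    smul_eq_mul]
  grind

theorem symPartial_eq {g : Matrix (Fin d) (Fin d) ℝ → Matrix (Fin d) (Fin d) ℝ}
    {g' : Matrix (Fin d) (Fin d) ℝ →L[ℝ] Matrix (Fin d) (Fin d) ℝ} {S : Matrix (Fin d) (Fin d) ℝ}
    (hS : S.PosDef) (hg : HasFDerivWithinAt g g' {A | A.PosDef} S) (a b i j : Fin d) :
    symPartial (fun A => g A a b) S i j = g' (symUnit i j) a b := by
  have hl := hasDerivAt_line S (symUnit i j)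
  have hmem : ∀ᶠ t : ℝ in 𝓝 0, (S + t • symUnit i j).PosDef := by
    have : Tendsto (fun t : ℝ => S + t • symUnit i j) (𝓝 0) (𝓝[{A | A.IsHermitian}] S) := by
      refine tendsto_nhdsWithin_iff.2 ⟨?_, Eventually.of_forall fun t => ?_⟩
      · have h := hl.continuousAt.tendsto
        rw [zero_smul, add_zero] at h
        exact h
      · exact hS.isHermitian.add ((isHermitian_symUnit i j).smul (IsSelfAdjoint.all t))
    exact this (posDef_mem_nhdsWithin hS)
  have h1 : HasDerivAt (fun t : ℝ => g (S + t • symUnit i j)) (g' (symUnit i j)) 0 := by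
    have := HasFDerivWithinAt.comp_hasDerivAt_of_eq (x := (0 : ℝ)) (t := {A | A.PosDef})
      (f := fun t : ℝ => S + t • symUnit i j) hg hl hmem (by simp)
    exact this
  have h2 := ((LinearMap.toContinuousLinearMap (Matrix.entryLinearMap ℝ ℝ a b)).hasFDerivAt
    (x := g (S + (0 : ℝ) • symUnit i j))).comp_hasDerivAt (0 : ℝ) h1
  exact h2.deriv

theorem symDiv_eq {g : Matrix (Fin d) (Fin d) ℝ → Matrix (Fin d) (Fin d) ℝ}
    {g' : Matrix (Fin d) (Fin d) ℝ →L[ℝ] Matrix (Fin d) (Fin d) ℝ} {S : Matrix (Fin d) (Fin d) ℝ}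
    (hS : S.PosDef) (hg : HasFDerivWithinAt g g' {A | A.PosDef} S) :
    symDiv g S = ∑ i, ∑ j, 1 / 2 * g' (Matrix.single i j 1 + Matrix.single j i 1) i j := by
  refine Finset.sum_congr rfl fun i _ => Finset.sum_congr rfl fun j _ => ?_
  rw [symPartial_eq hS hg, ← smul_eq_mul, ← Matrix.smul_apply, ← map_smul, symUnit_weight, map_smul]
  rfl

end Calculus

/-! ### The Wishart law as the image of a standard Gaussian. -/

section Law

variable {d D : ℕ}

/-- The `d × D` matrix with entries `z (k, i)` at `(i, k)`. -/
def entryMat (d D : ℕ) : (Fin D × Fin d → ℝ) →ₗ[ℝ] Matrix (Fin d) (Fin D) ℝ where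
  toFun z := Matrix.of fun i k => z (k, i)
  map_add' _ _ := rfl
  map_smul' _ _ := rfl

@[simp] theorem entryMat_apply (z : Fin D × Fin d → ℝ) (i : Fin d) (k : Fin D) :
    entryMat d D z i k = z (k, i) := rfl

/-- The Gram matrix `(A Z) (A Z)ᵀ`, where `Z` is the matrix with entries `z`. -/
def gram (A : Matrix (Fin d) (Fin d) ℝ) (z : Fin D × Fin d → ℝ) : Matrix (Fin d) (Fin d) ℝ :=
  (A * entryMat d D z) * (A * entryMat d D z)ᵀ

theorem continuous_gram (A : Matrix (Fin d) (Fin d) ℝ) :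
    Continuous (gram A : (Fin D × Fin d → ℝ) → _) := by
  have : Continuous (entryMat d D) := (entryMat d D).continuous_of_finiteDimensional
  unfold gram
  fun_prop

theorem stdGauss_eq_map_curry (d D : ℕ) :
    (Measure.pi fun _ : Fin D => stdGauss (Fin d)) =
      (stdGauss (Fin D × Fin d)).map fun z k i => z (k, i) := by
  have h := Measure.infinitePi_map_curry (ι := Fin D) (κ := Fin d)
    (fun _ _ => gaussianReal 0 1)
  simp only [Measure.infinitePi_eq_pi] at h
  exact h.symm

theorem exists_multivariateGaussian_eq_map {V : Matrix (Fin d) (Fin d) ℝ} (hV : V.PosSemidef) :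
    ∃ A : Matrix (Fin d) (Fin d) ℝ, A * Aᵀ = V ∧ multivariateGaussian 0 V =
      (stdGauss (Fin d)).map fun x => WithLp.toLp 2 (A *ᵥ x) := by
  open scoped MatrixOrder in
  have h1 : CFC.sqrt V * CFC.sqrt V = V := CFC.sqrt_mul_sqrt_self _ hV.nonneg
  have h2 : (CFC.sqrt V).IsHermitian := (CFC.sqrt_nonneg V).isSelfAdjoint
  refine ⟨CFC.sqrt V, ?_, ?_⟩
  · have : (CFC.sqrt V)ᵀ = CFC.sqrt V := h2
    rw [this, h1]
  · rw [multivariateGaussian, ← map_pi_eq_stdGaussian, Measure.map_map (by fun_prop) (by fun_prop)]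
    congr 1
    ext x
    simp

/-- All D columns are flattened into one Gaussian vector indexed by `Fin D × Fin d`, so that
integration by parts applies in all entries at once. Later only A Aᵀ = V is used, not that A is the
square root of V. -/
theorem exists_wishart_eq_map (D : ℕ) {V : Matrix (Fin d) (Fin d) ℝ} (hV : V.PosSemidef) :
    ∃ A : Matrix (Fin d) (Fin d) ℝ, A * Aᵀ = V ∧
      wishart d D V = (stdGauss (Fin D × Fin d)).map (gram A) := by
  obtain ⟨A, hA, h⟩ := exists_multivariateGaussian_eq_map hV
  refine ⟨A, hA, ?_⟩
  have hm : Measurable fun x : Fin d → ℝ => WithLp.toLp 2 (A *ᵥ x) := by fun_prop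
  have : IsProbabilityMeasure ((stdGauss (Fin d)).map fun x => WithLp.toLp 2 (A *ᵥ x)) :=
    Measure.isProbabilityMeasure_map hm.aemeasurable
  have hpi := Measure.pi_map_pi (μ := fun _ : Fin D => stdGauss (Fin d))
    (f := fun _ x => WithLp.toLp 2 (A *ᵥ x)) (fun _ => hm.aemeasurable)
  have hm2 : Measurable fun (x : Fin D → Fin d → ℝ) k => WithLp.toLp 2 (A *ᵥ x k) := by fun_prop
  have hm3 : Measurable fun (z : Fin D × Fin d → ℝ) (k : Fin D) (i : Fin d) => z (k, i) := by
    fun_prop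
  rw [wishart, h, ← hpi, stdGauss_eq_map_curry, Measure.map_map hm2 hm3,
    Measure.map_map (measurable_gram d D) (hm2.comp hm3)]
  rfl

/-- It suffices that the first d columns of Z form an invertible matrix M. On each line M + t·1 the
determinant is the characteristic polynomial of −M at t, with finitely many roots, so the singular
set is null along every such line and hence null. -/
theorem ae_posDef_gram (hdD : d ≤ D) {A : Matrix (Fin d) (Fin d) ℝ} (hA : IsUnit A) :
    ∀ᵐ z ∂stdGauss (Fin D × Fin d), (gram A z).PosDef := by
  let c : Fin d → Fin D := Fin.castLE hdD
  have hdet : ∀ᵐ z : Fin D × Fin d → ℝ, ((entryMat d D z).submatrix id c).det ≠ 0 := by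
    let L : ℝ →ₗ[ℝ] (Fin D × Fin d → ℝ) := LinearMap.toSpanSingleton ℝ _
      fun p => if p.1 = c p.2 then 1 else 0
    have hL : ∀ t z, (entryMat d D (z + L t)).submatrix id c =
        Matrix.scalar (Fin d) t - -(entryMat d D z).submatrix id c := fun t z => by
      ext i j
      simp [L, Matrix.diagonal_apply, c, Fin.ext_iff, add_comm, eq_comm]
    refine ae_mem_of_ae_add_linearMap_mem L volume volume
      (s := {z | ((entryMat d D z).submatrix id c).det ≠ 0}) ?_ fun z => ?_
    · refine (isOpen_ne_fun ?_ continuous_const).measurableSet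
      have : Continuous (entryMat d D) := (entryMat d D).continuous_of_finiteDimensional
      fun_prop
    · have hfin : {t : ℝ | ¬ (z + L t ∈ {z | ((entryMat d D z).submatrix id c).det ≠ 0})} ⊆
          {t | (Matrix.charpoly (-(entryMat d D z).submatrix id c)).IsRoot t} := fun t ht => by
        simp only [Set.mem_ofPred_eq, not_not] at ht
        rw [hL] at ht
        rw [Set.mem_ofPred_eq, Polynomial.IsRoot.def, Matrix.eval_charpoly, ht]
      exact measure_mono_null hfin
        ((Polynomial.finite_setOfPred_isRoot (Matrix.charpoly_monic _).ne_zero).measure_zero _)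
  have habs : stdGauss (Fin D × Fin d) ≪ volume := by
    rw [stdGauss_eq_withDensity]
    exact withDensity_absolutelyContinuous _ _
  filter_upwards [habs.ae_le hdet] with z hz
  refine Matrix.PosDef.mul_conjTranspose_self _ ?_
  intro x y hxy
  have h1 : IsUnit ((A * entryMat d D z).submatrix id c) := by
    have : (A * entryMat d D z).submatrix id c = A * (entryMat d D z).submatrix id c := by
      ext i j; simp [Matrix.mul_apply]
    rw [this]
    exact hA.mul ((Matrix.isUnit_iff_isUnit_det _).2 hz.isUnit)
  refine Matrix.vecMul_injective_of_isUnit h1 ?_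
  ext j
  exact congrFun hxy (c j)

theorem isOpenPosMeasure_stdGauss (ι : Type*) [Fintype ι] :
    (stdGauss ι).IsOpenPosMeasure := by
  have : (gaussianReal 0 1).IsOpenPosMeasure :=
    (gaussianReal_absolutelyContinuous' 0 one_ne_zero).isOpenPosMeasure
  infer_instance

theorem exists_gram_eq (hdD : d ≤ D) {A S : Matrix (Fin d) (Fin d) ℝ} (hA : IsUnit A)
    (hS : S.PosSemidef) : ∃ z : Fin D × Fin d → ℝ, gram A z = S := by
  obtain ⟨B, hB⟩ := exists_multivariateGaussian_eq_map hS
  let c : Fin d → Fin D := Fin.castLE hdD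
  have hAu : A * A⁻¹ = 1 := Matrix.mul_nonsing_inv _ ((Matrix.isUnit_iff_isUnit_det _).1 hA)
  -- The witness is Z = A⁻¹ B P with B Bᵀ = S, where P pads by zero columns and satisfies P Pᵀ = 1.
  refine ⟨fun p => ∑ j, (A⁻¹ * B) p.2 j * if p.1 = c j then 1 else 0, ?_⟩
  have h : ∀ z : Fin D × Fin d → ℝ, gram A z =
      A * (entryMat d D z * (entryMat d D z)ᵀ) * Aᵀ := fun z => by
    simp only [gram, Matrix.transpose_mul, Matrix.mul_assoc]
  have h2 : ∀ C : Matrix (Fin d) (Fin d) ℝ,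
      entryMat d D (fun p => ∑ j, C p.2 j * if p.1 = c j then 1 else 0) *
        (entryMat d D (fun p => ∑ j, C p.2 j * if p.1 = c j then 1 else 0))ᵀ = C * Cᵀ := fun C => by
    let P : Matrix (Fin d) (Fin D) ℝ := Matrix.of fun j k => if k = c j then 1 else 0
    have hP : entryMat d D (fun p => ∑ j, C p.2 j * if p.1 = c j then 1 else 0) = C * P := rfl
    have hPP : P * Pᵀ = 1 := by
      ext i j
      simp [P, Matrix.mul_apply, Matrix.one_apply, c, eq_comm]
    rw [hP, Matrix.transpose_mul, Matrix.mul_assoc, ← Matrix.mul_assoc P, hPP, Matrix.one_mul]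
  rw [h, h2, Matrix.transpose_mul, ← hB.1]
  calc A * (A⁻¹ * B * (Bᵀ * (A⁻¹)ᵀ)) * Aᵀ = (A * A⁻¹) * (B * Bᵀ) * (A * A⁻¹)ᵀ := by
        simp only [Matrix.transpose_mul, Matrix.mul_assoc]
    _ = B * Bᵀ := by rw [hAu, Matrix.transpose_one, Matrix.one_mul, Matrix.mul_one]

/-- Two functions that are continuous on the positive definite matrices and agree almost surely
under a Wishart law agree at all positive definite matrices. -/
theorem eqOn_posDef_of_ae_eq (hdD : d ≤ D) {A : Matrix (Fin d) (Fin d) ℝ} (hA : IsUnit A)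
    {f g : Matrix (Fin d) (Fin d) ℝ → Matrix (Fin d) (Fin d) ℝ}
    (hf : ContinuousOn f {S | S.PosDef}) (hg : ContinuousOn g {S | S.PosDef})
    (h : ∀ᵐ z ∂stdGauss (Fin D × Fin d), f (gram A z) = g (gram A z)) :
    Set.EqOn f g {S | S.PosDef} := by
  have := isOpenPosMeasure_stdGauss (Fin D × Fin d)
  have hps : ∀ z : Fin D × Fin d → ℝ, (gram A z).PosSemidef := fun z =>
    Matrix.posSemidef_self_mul_conjTranspose _
  have hU : {z : Fin D × Fin d → ℝ | (gram A z).PosDef} = {z | (gram A z).det ≠ 0} := by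
    ext z
    exact (hps z).posDef_iff_det_ne_zero
  have hUo : IsOpen {z : Fin D × Fin d → ℝ | (gram A z).PosDef} := by
    rw [hU]
    exact isOpen_ne_fun (differentiable_det.continuous.comp (continuous_gram A)) continuous_const
  -- The Gaussian charges every open set, so almost sure equality of continuous functions holds
  -- everywhere on this open set of z, which `gram A` maps onto the cone.
  have key := Measure.eqOn_open_of_ae_eq (μ := stdGauss (Fin D × Fin d))
    (f := fun z => f (gram A z)) (g := fun z => g (gram A z)) (ae_restrict_of_ae h) hUo
    (hf.comp (continuous_gram A).continuousOn fun z hz => hz)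
    (hg.comp (continuous_gram A).continuousOn fun z hz => hz)
  intro S hS
  obtain ⟨z, rfl⟩ := exists_gram_eq hdD hA hS.posSemidef
  exact key hS

end Law

/-! ### Traces of derivatives over matrix units. -/

section MatrixSums

variable {d D : ℕ}

/-- Both sides are traces of endomorphisms of matrix space, conjugate to each other under left
multiplication by A. -/
theorem sum_conj_single (T : Matrix (Fin d) (Fin D) ℝ →ₗ[ℝ] Matrix (Fin d) (Fin D) ℝ)
    {A : Matrix (Fin d) (Fin d) ℝ} (hA : IsUnit A) :
    ∑ i, ∑ k, (A⁻¹ * T (A * Matrix.single i k (1 : ℝ))) i k = ∑ i, ∑ k, T (Matrix.single i k (1 : ℝ)) i k := by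
  have hAu : A * A⁻¹ = 1 := Matrix.mul_nonsing_inv _ ((Matrix.isUnit_iff_isUnit_det _).1 hA)
  have h1 : ∀ i k, A * Matrix.single i k (1 : ℝ) =
      ∑ a, A a i • (Matrix.single a k (1 : ℝ) : Matrix (Fin d) (Fin D) ℝ) := fun i k => by
    ext b l
    simp [Matrix.sum_apply, Matrix.mul_apply, Matrix.single_apply, ite_and]
  have h2 : ∀ a b, ∑ i, A a i * A⁻¹ i b = if a = b then 1 else 0 := fun a b => by
    rw [← Matrix.mul_apply, hAu, Matrix.one_apply]
  have h3 : ∀ i k, (A⁻¹ * T (A * Matrix.single i k (1 : ℝ))) i k =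
      ∑ a, ∑ b, A a i * A⁻¹ i b * T (Matrix.single a k (1 : ℝ)) b k := fun i k => by
    rw [h1, map_sum, Matrix.mul_sum, Matrix.sum_apply]
    refine Finset.sum_congr rfl fun a _ => ?_
    rw [map_smul, Matrix.mul_smul, Matrix.smul_apply, Matrix.mul_apply, smul_eq_mul,
      Finset.mul_sum]
    exact Finset.sum_congr rfl fun b _ => by ring
  simp_rw [h3]
  calc ∑ i, ∑ k, ∑ a, ∑ b, A a i * A⁻¹ i b * T (Matrix.single a k (1 : ℝ)) b k
      = ∑ k, ∑ a, ∑ b, (∑ i, A a i * A⁻¹ i b) * T (Matrix.single a k (1 : ℝ)) b k := by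
        rw [Finset.sum_comm]
        refine Finset.sum_congr rfl fun k _ => ?_
        rw [Finset.sum_comm]
        refine Finset.sum_congr rfl fun a _ => ?_
        rw [Finset.sum_comm]
        exact Finset.sum_congr rfl fun b _ => (Finset.sum_mul _ _ _).symm
    _ = ∑ k, ∑ a, T (Matrix.single a k (1 : ℝ)) a k := by simp [h2]
    _ = _ := Finset.sum_comm

theorem mul_single_mul_apply {p q r s : ℕ} (P : Matrix (Fin p) (Fin q) ℝ)
    (Q : Matrix (Fin r) (Fin s) ℝ) (a : Fin p) (i : Fin q) (k : Fin r) (b : Fin s) :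
    (P * Matrix.single i k (1 : ℝ) * Q) a b = P a i * Q k b := by
  simp [Matrix.mul_apply, Matrix.single_apply, ite_and]

/-- The chain rule for Σ = GGᵀ: moving G_ik moves Σ along ∑_b G_bk (E_ib + E_bi), and contracting
over k with P, where P Gᵀ = 1, keeps only b equal to the column index of L. -/
theorem sum_linear_single (L : Matrix (Fin d) (Fin d) ℝ →ₗ[ℝ] Matrix (Fin d) (Fin d) ℝ)
    {G P : Matrix (Fin d) (Fin D) ℝ} (hPG : P * Gᵀ = 1) :
    ∑ i, ∑ k, (L (Matrix.single i k (1 : ℝ) * Gᵀ + G * (Matrix.single i k (1 : ℝ))ᵀ) * P) i k =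
      ∑ i, ∑ j, L (Matrix.single i j (1 : ℝ) + Matrix.single j i (1 : ℝ)) i j := by
  have h1 : ∀ i k, Matrix.single i k (1 : ℝ) * Gᵀ + G * (Matrix.single i k (1 : ℝ))ᵀ =
      ∑ b, G b k • (Matrix.single i b (1 : ℝ) + Matrix.single b i (1 : ℝ)) := fun i k => by
    ext a c
    simp only [Matrix.add_apply, Matrix.sum_apply, Matrix.mul_apply, Matrix.single_apply,
      Matrix.transpose_apply, Matrix.smul_apply, smul_eq_mul, mul_add, Finset.sum_add_distrib]
    congr 1 <;> simp [ite_and]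
  have h2 : ∀ l b, ∑ k, G b k * P l k = if l = b then 1 else 0 := fun l b => by
    rw [← Matrix.one_apply, ← hPG, Matrix.mul_apply]
    exact Finset.sum_congr rfl fun k _ => mul_comm _ _
  have h3 : ∀ i k, (L (Matrix.single i k (1 : ℝ) * Gᵀ + G * (Matrix.single i k (1 : ℝ))ᵀ) * P) i k =
      ∑ l, ∑ b, G b k * P l k * L (Matrix.single i b (1 : ℝ) + Matrix.single b i (1 : ℝ)) i l := fun i k => by
    rw [h1, map_sum, Matrix.mul_apply]
    refine Finset.sum_congr rfl fun l _ => ?_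
    rw [Matrix.sum_apply, Finset.sum_mul]
    refine Finset.sum_congr rfl fun b _ => ?_
    rw [map_smul, Matrix.smul_apply, smul_eq_mul]
    ring
  simp_rw [h3]
  refine Finset.sum_congr rfl fun i _ => ?_
  calc ∑ k, ∑ l, ∑ b, G b k * P l k * L (Matrix.single i b (1 : ℝ) + Matrix.single b i (1 : ℝ)) i l
      = ∑ l, ∑ b, (∑ k, G b k * P l k) * L (Matrix.single i b (1 : ℝ) + Matrix.single b i (1 : ℝ)) i l := by
        rw [Finset.sum_comm]
        refine Finset.sum_congr rfl fun l _ => ?_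
        rw [Finset.sum_comm]
        exact Finset.sum_congr rfl fun b _ => (Finset.sum_mul _ _ _).symm
    _ = _ := by simp [h2]

/-- Here S plays Σ⁻¹ and the field is h(Σ)Σ⁻¹G. The coefficient D − d − 1 arises as follows: D from
differentiating the last factor G, and −d and −1 from the two halves of the derivative of GGᵀ inside
Σ⁻¹. -/
theorem sum_deriv_single (L : Matrix (Fin d) (Fin d) ℝ →ₗ[ℝ] Matrix (Fin d) (Fin d) ℝ)
    (H : Matrix (Fin d) (Fin d) ℝ) {S : Matrix (Fin d) (Fin d) ℝ} {G : Matrix (Fin d) (Fin D) ℝ}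
    (hS : S * (G * Gᵀ) = 1) (hSt : Sᵀ = S) :
    ∑ i : Fin d, ∑ k : Fin D, ((L (Matrix.single i k (1 : ℝ) * Gᵀ + G * (Matrix.single i k (1 : ℝ))ᵀ) * S +
        H * -(S * (Matrix.single i k (1 : ℝ) * Gᵀ + G * (Matrix.single i k (1 : ℝ))ᵀ) * S)) * G +
        H * S * Matrix.single i k (1 : ℝ)) i k =
      ∑ i, ∑ j, L (Matrix.single i j (1 : ℝ) + Matrix.single j i (1 : ℝ)) i j +
        ((D : ℝ) - d - 1) * (H * S).trace := by
  have h0 : S * G * Gᵀ = 1 := by rw [Matrix.mul_assoc, hS]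
  have h0' : G * Gᵀ * S = 1 := mul_eq_one_comm.1 hS
  have h1 := sum_linear_single L h0
  have h2 : ∀ i k, (H * S * Matrix.single i k (1 : ℝ) : Matrix (Fin d) (Fin D) ℝ) i k =
      (H * S) i i := fun i k => by
    simpa only [Matrix.mul_one, Matrix.one_apply_eq, mul_one] using mul_single_mul_apply (H * S) (1 : Matrix (Fin D) (Fin D) ℝ) i i k k
  have h3 : ∑ i, ∑ k, (H * S) i i * (Gᵀ * S * G) k k = d * (H * S).trace := by
    have : (Gᵀ * S * G).trace = d := by
      rw [Matrix.trace_mul_comm, ← Matrix.mul_assoc, h0', Matrix.trace_one, Fintype.card_fin]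
    simp_rw [← Finset.mul_sum, ← Finset.sum_mul]
    rw [mul_comm]
    congr 1
  have h4 : ∑ i, ∑ k, (H * S * G) i k * (S * G) i k = (H * S).trace := by
    have : (H * S * G) * (S * G)ᵀ = H * S := by
      rw [Matrix.transpose_mul, hSt, Matrix.mul_assoc (H * S), ← Matrix.mul_assoc G, h0',
        Matrix.mul_one]
    rw [← congrArg Matrix.trace this, Matrix.trace]
    refine Finset.sum_congr rfl fun i _ => ?_
    rw [Matrix.diag_apply, Matrix.mul_apply]
    rfl
  have h5 : ∀ i k, ((L (Matrix.single i k (1 : ℝ) * Gᵀ + G * (Matrix.single i k (1 : ℝ))ᵀ) * S +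
        H * -(S * (Matrix.single i k (1 : ℝ) * Gᵀ + G * (Matrix.single i k (1 : ℝ))ᵀ) * S)) * G +
        H * S * Matrix.single i k (1 : ℝ)) i k =
      (L (Matrix.single i k (1 : ℝ) * Gᵀ + G * (Matrix.single i k (1 : ℝ))ᵀ) * (S * G)) i k -
        (H * S) i i * (Gᵀ * S * G) k k - (H * S * G) i k * (S * G) i k + (H * S) i i := fun i k => by
    rw [← mul_single_mul_apply (H * S) (Gᵀ * S * G) i i k k,
      ← mul_single_mul_apply (H * S * G) (S * G) i k i k, ← h2 i k,
      ← Matrix.sub_apply, ← Matrix.sub_apply, ← Matrix.add_apply]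
    rw [Matrix.transpose_single]
    simp only [Matrix.mul_add, Matrix.add_mul, Matrix.mul_neg, Matrix.neg_mul, Matrix.mul_assoc]
    abel_nf
  have h6 : ∑ i : Fin d, ∑ _k : Fin D, (H * S) i i = D * (H * S).trace := by
    simp [Matrix.trace, Finset.mul_sum]
  simp_rw [h5, Finset.sum_add_distrib, Finset.sum_sub_distrib, h1, h3, h4, h6]
  ring

end MatrixSums

/-! ### The divergence of the Stein field. -/

section CompactStein

variable {d D : ℕ}

/-- The integrand of Stein's identity for the Wishart distribution `W_d(D; V)`. -/
noncomputable def steinOp (D : ℕ) (V : Matrix (Fin d) (Fin d) ℝ)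
    (h : Matrix (Fin d) (Fin d) ℝ → Matrix (Fin d) (Fin d) ℝ) (S : Matrix (Fin d) (Fin d) ℝ) : ℝ :=
  symDiv h S + 1 / 2 * (h S * (((D : ℝ) - d - 1) • S⁻¹ - V⁻¹)).trace

/-- The vector field on Gaussian matrices whose divergence computes `steinOp`. -/
noncomputable def steinField (A : Matrix (Fin d) (Fin d) ℝ)
    (h : Matrix (Fin d) (Fin d) ℝ → Matrix (Fin d) (Fin d) ℝ) (z : Fin D × Fin d → ℝ) :
    Matrix (Fin d) (Fin D) ℝ :=
  A⁻¹ * (h (gram A z) * (gram A z)⁻¹ * (A * entryMat d D z))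

/-- Left multiplication by a matrix as a linear map. -/
def leftMulMat (A : Matrix (Fin d) (Fin d) ℝ) :
    Matrix (Fin d) (Fin D) ℝ →ₗ[ℝ] Matrix (Fin d) (Fin D) ℝ where
  toFun X := A * X
  map_add' := Matrix.mul_add A
  map_smul' c X := Matrix.mul_smul A c X

theorem exists_hasFDerivAt_gram (A : Matrix (Fin d) (Fin d) ℝ) (z : Fin D × Fin d → ℝ) :
    ∃ L : (Fin D × Fin d → ℝ) →L[ℝ] Matrix (Fin d) (Fin d) ℝ, HasFDerivAt (gram A) L z ∧
      ∀ v, L v = A * entryMat d D v * (A * entryMat d D z)ᵀ +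
        A * entryMat d D z * (A * entryMat d D v)ᵀ :=
  exists_hasFDerivAt_matrix_mul (z := z)
    (LinearMap.toContinuousLinearMap
      ((leftMulMat A) ∘ₗ entryMat d D)).hasFDerivAt
    (LinearMap.toContinuousLinearMap
      ((Matrix.transposeLinearEquiv (Fin d) (Fin D) ℝ ℝ).toLinearMap ∘ₗ
        (leftMulMat A) ∘ₗ entryMat d D)).hasFDerivAt

theorem exists_hasFDerivAt_steinField {A : Matrix (Fin d) (Fin d) ℝ}
    {h : Matrix (Fin d) (Fin d) ℝ → Matrix (Fin d) (Fin d) ℝ} {z : Fin D × Fin d → ℝ}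
    (hz : (gram A z).PosDef) {h' : Matrix (Fin d) (Fin d) ℝ →L[ℝ] Matrix (Fin d) (Fin d) ℝ}
    (hh : HasFDerivWithinAt h h' {S | S.PosDef} (gram A z)) :
    ∃ L : (Fin D × Fin d → ℝ) →L[ℝ] Matrix (Fin d) (Fin D) ℝ, HasFDerivAt (steinField A h) L z ∧
      ∀ v, L v = A⁻¹ *
        ((h' (A * entryMat d D v * (A * entryMat d D z)ᵀ +
            A * entryMat d D z * (A * entryMat d D v)ᵀ) * (gram A z)⁻¹ +
          h (gram A z) * -((gram A z)⁻¹ * (A * entryMat d D v * (A * entryMat d D z)ᵀ +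
            A * entryMat d D z * (A * entryMat d D v)ᵀ) * (gram A z)⁻¹)) * (A * entryMat d D z) +
        h (gram A z) * (gram A z)⁻¹ * (A * entryMat d D v)) := by
  obtain ⟨Lg, hLg, hLgv⟩ := exists_hasFDerivAt_gram A z
  have hmem : ∀ᶠ y in 𝓝 z, (gram A y).PosDef := by
    have : Tendsto (gram A) (𝓝 z) (𝓝[{S | S.IsHermitian}] (gram A z)) :=
      tendsto_nhdsWithin_iff.2 ⟨(continuous_gram A).continuousAt,
        Eventually.of_forall fun y => (Matrix.posSemidef_self_mul_conjTranspose _).isHermitian⟩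
    exact this (posDef_mem_nhdsWithin hz)
  have h1 : HasFDerivAt (fun y => h (gram A y)) (h'.comp Lg) z :=
    hh.comp_hasFDerivAt z hLg hmem
  obtain ⟨Li, hLi, hLiv⟩ := exists_hasFDerivAt_matrix_inv hz.isUnit
  have h2 : HasFDerivAt (fun y => (gram A y)⁻¹) (Li.comp Lg) z := hLi.comp z hLg
  obtain ⟨L3, h3, h3v⟩ := exists_hasFDerivAt_matrix_mul h1 h2
  obtain ⟨L4, h4, h4v⟩ := exists_hasFDerivAt_matrix_mul h3
    ((LinearMap.toContinuousLinearMap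
      ((leftMulMat A) ∘ₗ entryMat d D)).hasFDerivAt (x := z))
  obtain ⟨L5, h5, h5v⟩ := exists_hasFDerivAt_matrix_mul (hasFDerivAt_const A⁻¹ z) h4
  refine ⟨L5, h5, fun v => ?_⟩
  rw [h5v, h4v, h3v]
  simp only [ContinuousLinearMap.comp_apply, hLiv, hLgv]
  rw [zero_apply, Matrix.zero_mul, zero_add]
  rfl

theorem sum_fderiv_steinField {A : Matrix (Fin d) (Fin d) ℝ} (hA : IsUnit A)
    {h : Matrix (Fin d) (Fin d) ℝ → Matrix (Fin d) (Fin d) ℝ} {z : Fin D × Fin d → ℝ}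
    (hz : (gram A z).PosDef) {h' : Matrix (Fin d) (Fin d) ℝ →L[ℝ] Matrix (Fin d) (Fin d) ℝ}
    (hh : HasFDerivWithinAt h h' {S | S.PosDef} (gram A z)) :
    ∃ L : (Fin D × Fin d → ℝ) →L[ℝ] Matrix (Fin d) (Fin D) ℝ, HasFDerivAt (steinField A h) L z ∧
      ∑ p, L (Pi.single p 1) p.2 p.1 = 2 * symDiv h (gram A z) +
        ((D : ℝ) - d - 1) * (h (gram A z) * (gram A z)⁻¹).trace := by
  obtain ⟨L, hL, hLv⟩ := exists_hasFDerivAt_steinField hz hh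
  refine ⟨L, hL, ?_⟩
  set G := A * entryMat d D z with hG
  set S := (gram A z)⁻¹ with hS
  let T : Matrix (Fin d) (Fin D) ℝ →ₗ[ℝ] Matrix (Fin d) (Fin D) ℝ :=
    { toFun := fun X => (h' (X * Gᵀ + G * Xᵀ) * S +
          h (gram A z) * -(S * (X * Gᵀ + G * Xᵀ) * S)) * G + h (gram A z) * S * X
      map_add' := fun X Y => by
        have : (X + Y) * Gᵀ + G * (X + Y)ᵀ = (X * Gᵀ + G * Xᵀ) + (Y * Gᵀ + G * Yᵀ) := by
          rw [Matrix.transpose_add, Matrix.add_mul, Matrix.mul_add]; abel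
        rw [this, map_add]
        simp only [Matrix.mul_add, Matrix.add_mul, neg_add]
        abel
      map_smul' := fun c X => by
        have : (c • X) * Gᵀ + G * (c • X)ᵀ = c • (X * Gᵀ + G * Xᵀ) := by
          rw [Matrix.transpose_smul, Matrix.smul_mul, Matrix.mul_smul, smul_add]
        rw [this, map_smul]
        simp only [Matrix.mul_smul, Matrix.smul_mul, ← smul_neg, ← smul_add, RingHom.id_apply] }
  have h1 : ∀ i k, L (Pi.single (k, i) 1) = A⁻¹ * T (A * Matrix.single i k (1 : ℝ)) := fun i k => by
    have : entryMat d D (Pi.single (k, i) 1) = Matrix.single i k 1 := by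
      ext a b
      simp [Pi.single_apply, Matrix.single_apply, and_comm, eq_comm]
    rw [hLv, this]
    rfl
  have hSt : Sᵀ = S := hz.inv.isHermitian
  have h2 : S * (G * Gᵀ) = 1 :=
    Matrix.nonsing_inv_mul _ ((Matrix.isUnit_iff_isUnit_det _).1 hz.isUnit)
  have h3 := sum_deriv_single (L := h'.toLinearMap) (h (gram A z)) h2 hSt
  rw [Fintype.sum_prod_type_right]
  simp only [h1]
  rw [sum_conj_single T hA, symDiv_eq hz hh]
  simp only [← Finset.mul_sum]
  rw [← mul_assoc, mul_one_div_cancel two_ne_zero, one_mul]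
  exact h3

end CompactStein

/-! ### Stein's identity for fields of compact support. -/

section CompactSteinIdentity

variable {d D : ℕ}

theorem sq_frobenius_norm {m n : ℕ} (P : Matrix (Fin m) (Fin n) ℝ) :
    ‖P‖ ^ 2 = ∑ i, ∑ j, P i j ^ 2 := by
  rw [Matrix.frobenius_norm_def, ← Real.rpow_natCast, ← Real.rpow_mul (by positivity)]
  simp

theorem sq_frobenius_norm_eq_trace {m n : ℕ} (P : Matrix (Fin m) (Fin n) ℝ) :
    ‖P‖ ^ 2 = (P * Pᵀ).trace := by
  rw [sq_frobenius_norm]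
  simp [Matrix.trace, Matrix.mul_apply, sq]

theorem abs_entry_le_norm {m n : ℕ} (P : Matrix (Fin m) (Fin n) ℝ) (i : Fin m) (j : Fin n) :
    |P i j| ≤ ‖P‖ := by
  refine abs_le_of_sq_le_sq ?_ (norm_nonneg _)
  rw [sq_frobenius_norm]
  exact (Finset.single_le_sum (f := fun j => P i j ^ 2) (fun _ _ => sq_nonneg _)
    (Finset.mem_univ j)).trans (Finset.single_le_sum (f := fun i => ∑ j, P i j ^ 2)
      (fun _ _ => Finset.sum_nonneg fun _ _ => sq_nonneg _) (Finset.mem_univ i))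

theorem posSemidef_gram (A : Matrix (Fin d) (Fin d) ℝ) (z : Fin D × Fin d → ℝ) :
    (gram A z).PosSemidef := Matrix.posSemidef_self_mul_conjTranspose _

theorem isCompact_trace_gram_le {A : Matrix (Fin d) (Fin d) ℝ} (hA : IsUnit A) (R : ℝ) :
    IsCompact {z : Fin D × Fin d → ℝ | (gram A z).trace ≤ R} := by
  refine Metric.isCompact_of_isClosed_isBounded
    (isClosed_le (continuous_gram A).matrix_trace continuous_const) ?_
  refine (Metric.isBounded_closedBall (x := (0 : Fin D × Fin d → ℝ))
    (r := ‖A⁻¹‖ * √R)).subset fun z hz => ?_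
  have h1 : entryMat d D z = A⁻¹ * (A * entryMat d D z) := by
    rw [← Matrix.mul_assoc, Matrix.nonsing_inv_mul _ ((Matrix.isUnit_iff_isUnit_det _).1 hA),
      Matrix.one_mul]
  have h2 : ‖A * entryMat d D z‖ ≤ √R := by
    refine Real.le_sqrt_of_sq_le ?_
    rw [sq_frobenius_norm_eq_trace]
    exact hz
  rw [mem_closedBall_zero_iff, pi_norm_le_iff_of_nonneg (by positivity)]
  intro p
  calc ‖z p‖ = |entryMat d D z p.2 p.1| := rfl
    _ ≤ ‖entryMat d D z‖ := abs_entry_le_norm _ _ _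
    _ ≤ ‖A⁻¹‖ * ‖A * entryMat d D z‖ := by
      conv_lhs => rw [h1]
      exact Matrix.frobenius_norm_mul _ _
    _ ≤ _ := by gcongr

theorem steinOp_eq_zero {V : Matrix (Fin d) (Fin d) ℝ}
    {h : Matrix (Fin d) (Fin d) ℝ → Matrix (Fin d) (Fin d) ℝ} {S : Matrix (Fin d) (Fin d) ℝ}
    (hS : ∀ᶠ T in 𝓝 S, h T = 0) : steinOp D V h S = 0 := by
  have h1 : ∀ i j, symPartial (fun A => h A i j) S i j = 0 := fun i j => by
    have hc : Tendsto (fun t : ℝ => S + t • symUnit i j) (𝓝 0) (𝓝 S) := by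
      have := (hasDerivAt_line S (symUnit i j)).continuousAt.tendsto
      rw [zero_smul, add_zero] at this
      exact this
    have he : (fun t : ℝ => h (S + t • symUnit i j) i j) =ᶠ[𝓝 0] fun _ => (0 : ℝ) := by
      filter_upwards [hc hS] with t ht
      exact congrFun (congrFun ht i) j
    exact he.deriv_eq.trans (deriv_const _ _)
  simp [steinOp, symDiv, h1, hS.self_of_nhds]

/-- The source of the V⁻¹ term: A Z Zᵀ = Σ A⁻ᵀ, so Σ⁻¹ cancels and A⁻ᵀA⁻¹ = (A Aᵀ)⁻¹ is left by
cyclicity of the trace. -/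
theorem sum_mul_steinField {A : Matrix (Fin d) (Fin d) ℝ} (hA : IsUnit A)
    {h : Matrix (Fin d) (Fin d) ℝ → Matrix (Fin d) (Fin d) ℝ} {z : Fin D × Fin d → ℝ}
    (hz : (gram A z).PosDef) :
    ∑ p, z p * steinField A h z p.2 p.1 = (h (gram A z) * (A * Aᵀ)⁻¹).trace := by
  have hu := (Matrix.isUnit_iff_isUnit_det _).1 hA
  have hut : IsUnit (Aᵀ).det := by rwa [Matrix.det_transpose]
  have h1 : ∑ p, z p * steinField A h z p.2 p.1 =
      (steinField A h z * (entryMat d D z)ᵀ).trace := by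
    rw [Fintype.sum_prod_type_right, Matrix.trace]
    refine Finset.sum_congr rfl fun i _ => ?_
    rw [Matrix.diag_apply, Matrix.mul_apply]
    exact Finset.sum_congr rfl fun k _ => mul_comm _ _
  have h2 : A * entryMat d D z * (entryMat d D z)ᵀ = gram A z * (Aᵀ)⁻¹ := by
    rw [gram, Matrix.transpose_mul, ← Matrix.mul_assoc, Matrix.mul_nonsing_inv_cancel_right _ _ hut]
  have h3 : (gram A z)⁻¹ * gram A z = 1 :=
    Matrix.nonsing_inv_mul _ ((Matrix.isUnit_iff_isUnit_det _).1 hz.isUnit)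
  rw [h1, steinField, Matrix.mul_assoc, Matrix.mul_assoc, h2, Matrix.mul_assoc,
    ← Matrix.mul_assoc _ (gram A z), h3, Matrix.one_mul, Matrix.trace_mul_comm, Matrix.mul_assoc,
    Matrix.mul_inv_rev]

/-- The trace bound makes the field compactly supported in z, as tr Σ = ‖AZ‖². The determinant bound
makes it vanish near singular Gram matrices, where `h` is not controlled, so the field is
differentiable on the whole space. -/
theorem integral_steinOp_eq_zero_of_support (hd : 0 < d) (hD : 0 < D)
    {A : Matrix (Fin d) (Fin d) ℝ} (hA : IsUnit A)
    {h : Matrix (Fin d) (Fin d) ℝ → Matrix (Fin d) (Fin d) ℝ}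
    (hh : DifferentiableOn ℝ h {S | S.PosDef}) {R δ : ℝ} (hδ : 0 < δ)
    (hsupp : ∀ S, h S ≠ 0 → S.trace ≤ R ∧ δ ≤ S.det)
    (hint : Integrable (fun z => steinOp D (A * Aᵀ) h (gram A z)) (stdGauss (Fin D × Fin d))) :
    ∫ z, steinOp D (A * Aᵀ) h (gram A z) ∂stdGauss (Fin D × Fin d) = 0 := by
  have : Nonempty (Fin D × Fin d) := ⟨(⟨0, hD⟩, ⟨0, hd⟩)⟩
  have hzero : ∀ S : Matrix (Fin d) (Fin d) ℝ, S.det < δ → ∀ᶠ T in 𝓝 S, h T = 0 := fun S hS => by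
    filter_upwards [(isOpen_lt differentiable_det.continuous continuous_const).mem_nhds hS]
      with T hT
    by_contra hne
    exact absurd (hsupp T hne).2 (not_le.2 hT)
  have key : ∀ z : Fin D × Fin d → ℝ, ∃ L : (Fin D × Fin d → ℝ) →L[ℝ] Matrix (Fin d) (Fin D) ℝ,
      HasFDerivAt (steinField A h) L z ∧ ∑ p, L (Pi.single p 1) p.2 p.1 -
        ∑ p, z p * steinField A h z p.2 p.1 = 2 * steinOp D (A * Aᵀ) h (gram A z) := fun z => by
    by_cases hz : (gram A z).PosDef
    · obtain ⟨L, hL, hLs⟩ := sum_fderiv_steinField hA hz (hh _ hz).hasFDerivWithinAt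
      refine ⟨L, hL, ?_⟩
      rw [hLs, sum_mul_steinField hA hz, steinOp, Matrix.mul_sub, Matrix.mul_smul,
        Matrix.trace_sub, Matrix.trace_smul, smul_eq_mul]
      ring
    · have hdet : (gram A z).det < δ := by
        rw [(posSemidef_gram A z).posDef_iff_det_ne_zero, not_not] at hz
        rwa [hz]
      have h0 : steinField A h =ᶠ[𝓝 z] fun _ => 0 := by
        filter_upwards [(continuous_gram A).continuousAt (hzero _ hdet)] with y hy
        have hy' : h (gram A y) = 0 := hy
        rw [steinField, hy', Matrix.zero_mul, Matrix.zero_mul, Matrix.mul_zero]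
      refine ⟨0, (hasFDerivAt_const _ z).congr_of_eventuallyEq h0, ?_⟩
      rw [steinOp_eq_zero (hzero _ hdet), h0.self_of_nhds]
      simp
  choose L hL hLs using key
  let e : Matrix (Fin d) (Fin D) ℝ →L[ℝ] (Fin D × Fin d → ℝ) := LinearMap.toContinuousLinearMap
    { toFun := fun X p => X p.2 p.1, map_add' := fun _ _ => rfl, map_smul' := fun _ _ => rfl }
  have hF : ∀ z, HasFDerivAt (fun z => e (steinField A h z)) (e.comp (L z)) z := fun z =>
    e.hasFDerivAt.comp z (hL z)
  have hc : HasCompactSupport fun z => e (steinField A h z) := by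
    refine HasCompactSupport.of_support_subset_isCompact (isCompact_trace_gram_le hA R)
      fun z hz => ?_
    by_contra hne
    have h0 : h (gram A z) = 0 := by
      by_contra h0
      exact hne (hsupp _ h0).1
    refine hz ?_
    show e (steinField A h z) = 0
    rw [steinField, h0, Matrix.zero_mul, Matrix.zero_mul, Matrix.mul_zero, map_zero]
  have heq : ∀ z : Fin D × Fin d → ℝ, ∑ p, (e.comp (L z)) (Pi.single p 1) p -
      ∑ p, z p * e (steinField A h z) p = 2 * steinOp D (A * Aᵀ) h (gram A z) := hLs
  have hfin := integral_stein_stdGauss _ _ hF hc (by simp_rw [heq]; exact hint.const_mul 2)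
  simp_rw [heq] at hfin
  rw [integral_const_mul] at hfin
  linarith

end CompactSteinIdentity

/-! ### Smooth cutoffs in trace and determinant. -/

section Cutoff

theorem continuous_deriv_smoothTransition : Continuous (deriv Real.smoothTransition) :=
  (Real.smoothTransition.contDiff (n := 1)).continuous_deriv le_rfl

theorem deriv_smoothTransition_of_neg {x : ℝ} (hx : x < 0) : deriv Real.smoothTransition x = 0 := by
  have : Real.smoothTransition =ᶠ[𝓝 x] fun _ => 0 := by
    filter_upwards [gt_mem_nhds hx] with y hy
    exact Real.smoothTransition.zero_of_nonpos hy.le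
  rw [this.deriv_eq, deriv_const]

theorem deriv_smoothTransition_of_one_lt {x : ℝ} (hx : 1 < x) :
    deriv Real.smoothTransition x = 0 := by
  have : Real.smoothTransition =ᶠ[𝓝 x] fun _ => 1 := by
    filter_upwards [lt_mem_nhds hx] with y hy
    exact Real.smoothTransition.one_of_one_le hy.le
  rw [this.deriv_eq, deriv_const]

theorem deriv_smoothTransition_nonneg (x : ℝ) : 0 ≤ deriv Real.smoothTransition x :=
  Real.smoothTransition.monotone.deriv_nonneg

theorem exists_deriv_smoothTransition_le : ∃ C, 0 ≤ C ∧ ∀ x, deriv Real.smoothTransition x ≤ C := by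
  obtain ⟨C, hC⟩ := (isCompact_Icc (a := (0 : ℝ)) (b := 1)).bddAbove_image
    continuous_deriv_smoothTransition.continuousOn
  have hC' : ∀ x ∈ Set.Icc (0 : ℝ) 1, deriv Real.smoothTransition x ≤ C := fun x hx =>
    hC (Set.mem_image_of_mem _ hx)
  have h0 : 0 ≤ C := (deriv_smoothTransition_nonneg 0).trans (hC' 0 (by simp))
  refine ⟨C, h0, fun x => ?_⟩
  rcases lt_or_ge x 0 with hx | hx
  · rwa [deriv_smoothTransition_of_neg hx]
  rcases lt_or_ge 1 x with hx1 | hx1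
  · rwa [deriv_smoothTransition_of_one_lt hx1]
  exact hC' x ⟨hx, hx1⟩

variable {d : ℕ}

/-- A smooth cutoff that is supported on `tr S ≤ 2 / ε`, `ε ≤ det S`. -/
noncomputable def cutoff (ε : ℝ) (S : Matrix (Fin d) (Fin d) ℝ) : ℝ :=
  Real.smoothTransition (2 - ε * S.trace) * Real.smoothTransition (S.det / ε - 1)

/-- Minus the coefficient of `tr E` in the derivative of `cutoff ε` in the direction `E`. -/
noncomputable def cutoffTraceSlope (ε : ℝ) (S : Matrix (Fin d) (Fin d) ℝ) : ℝ :=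
  ε * deriv Real.smoothTransition (2 - ε * S.trace) * Real.smoothTransition (S.det / ε - 1)

/-- The coefficient of `tr (S⁻¹ E)` in the derivative of `cutoff ε` in the direction `E`. -/
noncomputable def cutoffDetSlope (ε : ℝ) (S : Matrix (Fin d) (Fin d) ℝ) : ℝ :=
  Real.smoothTransition (2 - ε * S.trace) *
    (deriv Real.smoothTransition (S.det / ε - 1) * (S.det / ε))

variable {ε : ℝ} {S : Matrix (Fin d) (Fin d) ℝ}

theorem cutoff_nonneg (ε : ℝ) (S : Matrix (Fin d) (Fin d) ℝ) : 0 ≤ cutoff ε S :=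
  mul_nonneg (Real.smoothTransition.nonneg _) (Real.smoothTransition.nonneg _)

theorem cutoff_le_one (ε : ℝ) (S : Matrix (Fin d) (Fin d) ℝ) : cutoff ε S ≤ 1 :=
  mul_le_one₀ (Real.smoothTransition.le_one _) (Real.smoothTransition.nonneg _)
    (Real.smoothTransition.le_one _)

theorem continuous_cutoff (ε : ℝ) :
    Continuous (cutoff ε : Matrix (Fin d) (Fin d) ℝ → ℝ) := by
  have h1 := Real.smoothTransition.continuous
  have h2 : Continuous fun S : Matrix (Fin d) (Fin d) ℝ => S.trace := continuous_id.matrix_trace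
  have h3 : Continuous fun S : Matrix (Fin d) (Fin d) ℝ => S.det := continuous_id.matrix_det
  unfold cutoff
  fun_prop

theorem continuous_cutoffTraceSlope (ε : ℝ) :
    Continuous (cutoffTraceSlope ε : Matrix (Fin d) (Fin d) ℝ → ℝ) := by
  have h1 := Real.smoothTransition.continuous
  have h2 : Continuous fun S : Matrix (Fin d) (Fin d) ℝ => S.trace := continuous_id.matrix_trace
  have h3 : Continuous fun S : Matrix (Fin d) (Fin d) ℝ => S.det := continuous_id.matrix_det
  have h4 := continuous_deriv_smoothTransition
  unfold cutoffTraceSlope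
  fun_prop

theorem continuous_cutoffDetSlope (ε : ℝ) :
    Continuous (cutoffDetSlope ε : Matrix (Fin d) (Fin d) ℝ → ℝ) := by
  have h1 := Real.smoothTransition.continuous
  have h2 : Continuous fun S : Matrix (Fin d) (Fin d) ℝ => S.trace := continuous_id.matrix_trace
  have h3 : Continuous fun S : Matrix (Fin d) (Fin d) ℝ => S.det := continuous_id.matrix_det
  have h4 := continuous_deriv_smoothTransition
  unfold cutoffDetSlope
  fun_prop

theorem mem_of_smoothTransition_trace_ne_zero (hε : 0 < ε)
    (h : Real.smoothTransition (2 - ε * S.trace) ≠ 0) : S.trace ≤ 2 / ε := by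
  rw [Ne, Real.smoothTransition.zero_iff_nonpos, not_le] at h
  rw [le_div_iff₀ hε]
  linarith

theorem mem_of_deriv_smoothTransition_trace_ne_zero (hε : 0 < ε)
    (h : deriv Real.smoothTransition (2 - ε * S.trace) ≠ 0) : S.trace ≤ 2 / ε := by
  by_contra hlt
  rw [not_le, div_lt_iff₀ hε] at hlt
  exact h (deriv_smoothTransition_of_neg (by linarith))

theorem mem_of_smoothTransition_det_ne_zero (hε : 0 < ε)
    (h : Real.smoothTransition (S.det / ε - 1) ≠ 0) : ε ≤ S.det := by
  rw [Ne, Real.smoothTransition.zero_iff_nonpos, not_le, sub_pos, one_lt_div hε] at h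
  exact h.le

theorem mem_of_deriv_smoothTransition_det_ne_zero (hε : 0 < ε)
    (h : deriv Real.smoothTransition (S.det / ε - 1) ≠ 0) : ε ≤ S.det := by
  by_contra hlt
  rw [not_le, ← div_lt_one hε] at hlt
  exact h (deriv_smoothTransition_of_neg (by linarith))

theorem cutoff_support (hε : 0 < ε) (h : cutoff ε S ≠ 0) : S.trace ≤ 2 / ε ∧ ε ≤ S.det :=
  ⟨mem_of_smoothTransition_trace_ne_zero hε (left_ne_zero_of_mul h),
    mem_of_smoothTransition_det_ne_zero hε (right_ne_zero_of_mul h)⟩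

theorem cutoffTraceSlope_support (hε : 0 < ε) (h : cutoffTraceSlope ε S ≠ 0) :
    S.trace ≤ 2 / ε ∧ ε ≤ S.det :=
  ⟨mem_of_deriv_smoothTransition_trace_ne_zero hε (right_ne_zero_of_mul (left_ne_zero_of_mul h)),
    mem_of_smoothTransition_det_ne_zero hε (right_ne_zero_of_mul h)⟩

theorem cutoffDetSlope_support (hε : 0 < ε) (h : cutoffDetSlope ε S ≠ 0) :
    S.trace ≤ 2 / ε ∧ ε ≤ S.det :=
  ⟨mem_of_smoothTransition_trace_ne_zero hε (left_ne_zero_of_mul h),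
    mem_of_deriv_smoothTransition_det_ne_zero hε (left_ne_zero_of_mul (right_ne_zero_of_mul h))⟩

theorem cutoffTraceSlope_nonneg (hε : 0 < ε) : 0 ≤ cutoffTraceSlope ε S :=
  mul_nonneg (mul_nonneg hε.le (deriv_smoothTransition_nonneg _)) (Real.smoothTransition.nonneg _)

theorem cutoffTraceSlope_le (hε : 0 < ε) {C : ℝ} (hC : ∀ x, deriv Real.smoothTransition x ≤ C) :
    cutoffTraceSlope ε S ≤ ε * C := by
  have h0 := mul_nonneg hε.le (deriv_smoothTransition_nonneg (2 - ε * S.trace))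
  exact (mul_le_of_le_one_right h0 (Real.smoothTransition.le_one _)).trans
    (mul_le_mul_of_nonneg_left (hC _) hε.le)

theorem cutoffDetSlope_nonneg (hε : 0 < ε) (hS : 0 ≤ S.det) : 0 ≤ cutoffDetSlope ε S :=
  mul_nonneg (Real.smoothTransition.nonneg _)
    (mul_nonneg (deriv_smoothTransition_nonneg _) (div_nonneg hS hε.le))

/-- The bound is uniform in ε: the derivative of the transition vanishes once det S / ε exceeds 2,
which caps the factor det S / ε. -/
theorem cutoffDetSlope_le (hε : 0 < ε) (hS : 0 ≤ S.det) {C : ℝ} (hC0 : 0 ≤ C)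
    (hC : ∀ x, deriv Real.smoothTransition x ≤ C) : cutoffDetSlope ε S ≤ 2 * C := by
  have h0 : 0 ≤ S.det / ε := div_nonneg hS hε.le
  have h1 := mul_nonneg (deriv_smoothTransition_nonneg (S.det / ε - 1)) h0
  refine (mul_le_of_le_one_left h1 (Real.smoothTransition.le_one _)).trans ?_
  rcases lt_or_ge 2 (S.det / ε) with h | h
  · rw [deriv_smoothTransition_of_one_lt (by linarith), zero_mul]
    positivity
  · rw [mul_comm 2 C]
    exact mul_le_mul (hC _) h h0 hC0

theorem exists_hasFDerivAt_cutoff (ε : ℝ) (hS : S.PosDef) :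
    ∃ L : Matrix (Fin d) (Fin d) ℝ →L[ℝ] ℝ, HasFDerivAt (cutoff ε) L S ∧
      ∀ E, L E = cutoffDetSlope ε S * (S⁻¹ * E).trace - cutoffTraceSlope ε S * E.trace := by
  obtain ⟨Ld, hLd, hLdv⟩ := hasFDerivAt_det hS.isUnit
  have hτ : ∀ x, HasDerivAt Real.smoothTransition (deriv Real.smoothTransition x) x := fun x =>
    ((Real.smoothTransition.contDiff (n := 1)).differentiable one_ne_zero x).hasDerivAt
  have ht : HasFDerivAt (fun S : Matrix (Fin d) (Fin d) ℝ => 2 - ε * S.trace)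
      (-(ε • LinearMap.toContinuousLinearMap (Matrix.traceLinearMap (Fin d) ℝ ℝ))) S :=
    ((LinearMap.toContinuousLinearMap
      (Matrix.traceLinearMap (Fin d) ℝ ℝ)).hasFDerivAt.const_mul ε).const_sub 2
  have hd' : HasFDerivAt (fun S : Matrix (Fin d) (Fin d) ℝ => S.det / ε - 1) (ε⁻¹ • Ld) S := by
    have := (hLd.const_mul ε⁻¹).sub_const 1
    simp only [div_eq_inv_mul]
    exact this
  have h1 := (hτ (2 - ε * S.trace)).comp_hasFDerivAt S ht
  have h2 := (hτ (S.det / ε - 1)).comp_hasFDerivAt S hd'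
  refine ⟨_, h1.mul h2, fun E => ?_⟩
  have : ∀ E, (ε⁻¹ • Ld) E = ε⁻¹ * (S.det * (S⁻¹ * E).trace) := fun E => by
    rw [← hLdv]; rfl
  show Real.smoothTransition (2 - ε * S.trace) *
      (deriv Real.smoothTransition (S.det / ε - 1) * (ε⁻¹ • Ld) E) +
    Real.smoothTransition (S.det / ε - 1) * (deriv Real.smoothTransition (2 - ε * S.trace) *
      -(ε * E.trace)) = _
  rw [this, cutoffDetSlope, cutoffTraceSlope]
  ring

theorem eventually_cutoff_eq (hS : S.PosDef) : ∀ᶠ n : ℕ in atTop,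
    cutoff (1 / ((n : ℝ) + 1)) S = 1 ∧ cutoffTraceSlope (1 / ((n : ℝ) + 1)) S = 0 ∧
      cutoffDetSlope (1 / ((n : ℝ) + 1)) S = 0 := by
  have h0 := tendsto_one_div_add_atTop_nhds_zero_nat (𝕜 := ℝ)
  have h1 : ∀ᶠ n : ℕ in atTop, 1 / ((n : ℝ) + 1) * S.trace < 1 := by
    have := h0.mul_const S.trace
    rw [zero_mul] at this
    exact this.eventually (gt_mem_nhds one_pos)
  have h2 : ∀ᶠ n : ℕ in atTop, 1 / ((n : ℝ) + 1) < S.det / 2 :=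
    h0.eventually (gt_mem_nhds (half_pos hS.det_pos))
  filter_upwards [h1, h2] with n hn1 hn2
  have hε : (0 : ℝ) < 1 / ((n : ℝ) + 1) := by positivity
  have hd : 1 < S.det / (1 / ((n : ℝ) + 1)) - 1 := by
    rw [lt_sub_iff_add_lt, lt_div_iff₀ hε]
    linarith
  have ht : 1 < 2 - 1 / ((n : ℝ) + 1) * S.trace := by linarith
  refine ⟨?_, ?_, ?_⟩
  · rw [cutoff, Real.smoothTransition.one_of_one_le hd.le,
      Real.smoothTransition.one_of_one_le ht.le, one_mul]
  · rw [cutoffTraceSlope, deriv_smoothTransition_of_one_lt ht, mul_zero, zero_mul]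
  · rw [cutoffDetSlope, deriv_smoothTransition_of_one_lt hd, zero_mul, mul_zero]

/-- The Leibniz rule: the extra term pairs `h` with the symmetric gradient of the cutoff, which is
`cutoffDetSlope` times S⁻¹ minus `cutoffTraceSlope` times the identity. -/
theorem steinOp_smul {D : ℕ} {V : Matrix (Fin d) (Fin d) ℝ} (hS : S.PosDef)
    {h : Matrix (Fin d) (Fin d) ℝ → Matrix (Fin d) (Fin d) ℝ}
    (hh : DifferentiableWithinAt ℝ h {A | A.PosDef} S) (ε : ℝ) :
    steinOp D V (fun A => cutoff ε A • h A) S = cutoff ε S * steinOp D V h S +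
      (cutoffDetSlope ε S * (S⁻¹ * h S).trace - cutoffTraceSlope ε S * (h S).trace) := by
  obtain ⟨L, hL, hLv⟩ := exists_hasFDerivAt_cutoff ε hS
  have h1 := hh.hasFDerivWithinAt
  set h' := fderivWithin ℝ h {A | A.PosDef} S
  have h2 : HasFDerivWithinAt (fun A => cutoff ε A • h A)
      (cutoff ε S • h' + L.smulRight (h S)) {A | A.PosDef} S := hL.hasFDerivWithinAt.smul h1
  have hst : ∀ i j, S⁻¹ j i = S⁻¹ i j := fun i j => congrFun (congrFun hS.inv.isHermitian i) j
  rw [steinOp, steinOp, symDiv_eq hS h2, symDiv_eq hS h1]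
  have h3 : ∀ i j, (cutoff ε S • h' + L.smulRight (h S))
      (Matrix.single i j 1 + Matrix.single j i 1) i j =
      cutoff ε S * h' (Matrix.single i j 1 + Matrix.single j i 1) i j +
        (cutoffDetSlope ε S * (2 * S⁻¹ i j) -
          cutoffTraceSlope ε S * (if i = j then 2 else 0)) * h S i j := fun i j => by
    have : L (Matrix.single i j 1 + Matrix.single j i 1) = cutoffDetSlope ε S * (2 * S⁻¹ i j) -
          cutoffTraceSlope ε S * (if i = j then 2 else 0) := by
      have ht : ∀ i j : Fin d, (Matrix.single i j (1 : ℝ)).trace = if i = j then 1 else 0 :=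
        fun i j => by
          by_cases hij : i = j
          · rw [hij, Matrix.trace_single_eq_same, if_pos rfl]
          · rw [Matrix.trace_single_eq_of_ne i j _ hij, if_neg hij]
      rw [hLv, Matrix.mul_add, Matrix.trace_add, Matrix.trace_add, Matrix.trace_mul_single,
        Matrix.trace_mul_single, hst i j, ht, ht]
      simp only [eq_comm (a := j) (b := i), MulOpposite.op_one, one_smul]
      split_ifs <;> ring
    rw [← this]
    rfl
  have h4 : ∑ i, ∑ j, S⁻¹ i j * h S i j = (S⁻¹ * h S).trace := by
    rw [Finset.sum_comm, Matrix.trace]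
    refine Finset.sum_congr rfl fun j _ => ?_
    rw [Matrix.diag_apply, Matrix.mul_apply]
    exact Finset.sum_congr rfl fun i _ => by rw [hst i j]
  have h5 : ∑ i, ∑ j, (if i = j then (1 : ℝ) else 0) * h S i j = (h S).trace := by
    simp [Matrix.trace]
  have h6 : ∀ i j, 1 / 2 * (cutoff ε S * h' (Matrix.single i j 1 + Matrix.single j i 1) i j +
        (cutoffDetSlope ε S * (2 * S⁻¹ i j) -
          cutoffTraceSlope ε S * (if i = j then 2 else 0)) * h S i j) =
      cutoff ε S * (1 / 2 * h' (Matrix.single i j 1 + Matrix.single j i 1) i j) +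
        (cutoffDetSlope ε S * (S⁻¹ i j * h S i j) -
          cutoffTraceSlope ε S * ((if i = j then 1 else 0) * h S i j)) := fun i j => by
    split_ifs <;> ring
  simp_rw [h3, h6, Finset.sum_add_distrib, Finset.sum_sub_distrib, ← Finset.mul_sum, h4, h5]
  rw [Matrix.smul_mul, Matrix.trace_smul, smul_eq_mul]
  ring

end Cutoff

/-! ### Removing the cutoff: Stein's identity and a one-sided version. -/

section Stein

variable {d D : ℕ}

theorem abs_trace_mul_le (P Q : Matrix (Fin d) (Fin d) ℝ) : |(P * Q).trace| ≤ ‖P‖ * ‖Q‖ := by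
  refine abs_le_of_sq_le_sq ?_ (by positivity)
  rw [mul_pow, sq_frobenius_norm, sq_frobenius_norm]
  have h1 : (P * Q).trace = ∑ p : Fin d × Fin d, P p.1 p.2 * Q p.2 p.1 := by
    rw [Fintype.sum_prod_type, Matrix.trace]
    rfl
  have h2 : ∑ i, ∑ j, P i j ^ 2 = ∑ p : Fin d × Fin d, P p.1 p.2 ^ 2 := by
    rw [Fintype.sum_prod_type]
  have h3 : ∑ i, ∑ j, Q i j ^ 2 = ∑ p : Fin d × Fin d, Q p.2 p.1 ^ 2 := by
    rw [Fintype.sum_prod_type_right]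
  rw [h1, h2, h3]
  exact Finset.sum_mul_sq_le_sq_mul_sq _ _ _

theorem isOpen_posDef_gram (A : Matrix (Fin d) (Fin d) ℝ) :
    IsOpen {z : Fin D × Fin d → ℝ | (gram A z).PosDef} := by
  have hU : {z : Fin D × Fin d → ℝ | (gram A z).PosDef} = {z | (gram A z).det ≠ 0} := by
    ext z
    exact (posSemidef_gram A z).posDef_iff_det_ne_zero
  rw [hU]
  exact isOpen_ne_fun (differentiable_det.continuous.comp (continuous_gram A)) continuous_const

theorem aestronglyMeasurable_comp_gram (hdD : d ≤ D) {A : Matrix (Fin d) (Fin d) ℝ}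
    (hA : IsUnit A) {E : Type*} [TopologicalSpace E] [TopologicalSpace.PseudoMetrizableSpace E]
    [SecondCountableTopology E] {f : Matrix (Fin d) (Fin d) ℝ → E}
    (hf : ContinuousOn f {S | S.PosDef}) :
    AEStronglyMeasurable (fun z => f (gram A z)) (stdGauss (Fin D × Fin d)) := by
  have h : ContinuousOn (fun z : Fin D × Fin d → ℝ => f (gram A z)) {z | (gram A z).PosDef} :=
    hf.comp (continuous_gram A).continuousOn fun z hz => hz
  have h2 := h.aestronglyMeasurable (μ := stdGauss (Fin D × Fin d))
    (isOpen_posDef_gram A).measurableSet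
  have h3 : (stdGauss (Fin D × Fin d)).restrict {z | (gram A z).PosDef} = stdGauss _ :=
    Measure.restrict_eq_self_of_ae_mem (ae_posDef_gram hdD hA)
  rwa [h3] at h2

theorem continuousOn_inv : ContinuousOn (fun S : Matrix (Fin d) (Fin d) ℝ => S⁻¹)
    {S | S.PosDef} := fun S hS => by
  obtain ⟨L, hL, -⟩ := exists_hasFDerivAt_matrix_inv hS.isUnit
  exact hL.continuousAt.continuousWithinAt

/-- The weight confines z to a compact set on which the Gram matrix stays in the cone, so the
product is bounded. -/
theorem integrable_mul_comp_gram (hdD : d ≤ D) {A : Matrix (Fin d) (Fin d) ℝ}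
    (hA : IsUnit A) {f ψ : Matrix (Fin d) (Fin d) ℝ → ℝ} (hf : ContinuousOn f {S | S.PosDef})
    (hψ : Continuous ψ) {R δ : ℝ} (hδ : 0 < δ) (hsupp : ∀ S, ψ S ≠ 0 → S.trace ≤ R ∧ δ ≤ S.det) :
    Integrable (fun z => ψ (gram A z) * f (gram A z)) (stdGauss (Fin D × Fin d)) := by
  have hK : IsCompact ({z : Fin D × Fin d → ℝ | (gram A z).trace ≤ R} ∩
      {z | δ ≤ (gram A z).det}) :=
    (isCompact_trace_gram_le hA R).inter_right
      (isClosed_le continuous_const (differentiable_det.continuous.comp (continuous_gram A)))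
  have hc : ContinuousOn (fun z : Fin D × Fin d → ℝ => ψ (gram A z) * f (gram A z))
      ({z : Fin D × Fin d → ℝ | (gram A z).trace ≤ R} ∩ {z | δ ≤ (gram A z).det}) := by
    refine (hψ.comp (continuous_gram A)).continuousOn.mul
      (hf.comp (continuous_gram A).continuousOn fun z hz => ?_)
    exact (posSemidef_gram A z).posDef_iff_det_ne_zero.2 (hδ.trans_le hz.2).ne'
  obtain ⟨C, hC⟩ := hK.exists_bound_of_continuousOn hc
  refine Integrable.of_bound ((hψ.comp (continuous_gram A)).aestronglyMeasurable.mul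
    (aestronglyMeasurable_comp_gram hdD hA hf)) (max C 0) (Eventually.of_forall fun z => ?_)
  by_cases h0 : ψ (gram A z) = 0
  · simp [h0]
  · exact (hC z (hsupp _ h0)).trans (le_max_left _ _)

theorem continuousOn_trace_inv_mul {h : Matrix (Fin d) (Fin d) ℝ → Matrix (Fin d) (Fin d) ℝ}
    (hh : ContinuousOn h {S | S.PosDef}) :
    ContinuousOn (fun S => (S⁻¹ * h S).trace) {S | S.PosDef} :=
  continuous_id.matrix_trace.comp_continuousOn (continuousOn_inv.mul hh)

theorem continuousOn_trace {h : Matrix (Fin d) (Fin d) ℝ → Matrix (Fin d) (Fin d) ℝ}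
    (hh : ContinuousOn h {S | S.PosDef}) : ContinuousOn (fun S => (h S).trace) {S | S.PosDef} :=
  continuous_id.matrix_trace.comp_continuousOn hh

theorem integral_steinOp_cutoff_eq_zero (hd : 0 < d) (hdD : d ≤ D)
    {A : Matrix (Fin d) (Fin d) ℝ} (hA : IsUnit A)
    {h : Matrix (Fin d) (Fin d) ℝ → Matrix (Fin d) (Fin d) ℝ}
    (hh : DifferentiableOn ℝ h {S | S.PosDef}) {ε : ℝ} (hε : 0 < ε)
    (hint : Integrable (fun z => cutoff ε (gram A z) * steinOp D (A * Aᵀ) h (gram A z))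
      (stdGauss (Fin D × Fin d))) :
    ∫ z, (cutoff ε (gram A z) * steinOp D (A * Aᵀ) h (gram A z) +
      (cutoffDetSlope ε (gram A z) * ((gram A z)⁻¹ * h (gram A z)).trace -
        cutoffTraceSlope ε (gram A z) * (h (gram A z)).trace)) ∂stdGauss (Fin D × Fin d) = 0 := by
  have hI1 := integrable_mul_comp_gram hdD hA (continuousOn_trace_inv_mul hh.continuousOn)
    (continuous_cutoffDetSlope ε) hε fun S => cutoffDetSlope_support hε
  have hI2 := integrable_mul_comp_gram hdD hA (continuousOn_trace hh.continuousOn)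
    (continuous_cutoffTraceSlope ε) hε fun S => cutoffTraceSlope_support hε
  have heq : (fun z => steinOp D (A * Aᵀ) (fun S => cutoff ε S • h S) (gram A z))
      =ᵐ[stdGauss (Fin D × Fin d)] fun z =>
        cutoff ε (gram A z) * steinOp D (A * Aᵀ) h (gram A z) +
          (cutoffDetSlope ε (gram A z) * ((gram A z)⁻¹ * h (gram A z)).trace -
            cutoffTraceSlope ε (gram A z) * (h (gram A z)).trace) := by
    filter_upwards [ae_posDef_gram hdD hA] with z hz
    exact steinOp_smul hz (hh _ hz) ε
  rw [← integral_congr_ae heq]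
  refine integral_steinOp_eq_zero_of_support hd (hd.trans_le hdD) hA (R := 2 / ε) (δ := ε)
    (fun S hS => ?_) hε (fun S hS => cutoff_support hε (left_ne_zero_of_smul hS))
    ((hint.add (hI1.sub hI2)).congr heq.symm)
  obtain ⟨L, hL, -⟩ := exists_hasFDerivAt_cutoff ε hS
  exact (hL.hasFDerivWithinAt.smul (hh S hS).hasFDerivWithinAt).differentiableWithinAt

/-- **Stein's identity** for the Wishart distribution. -/
theorem integral_steinOp_eq_zero (hd : 0 < d) (hdD : d ≤ D)
    {A : Matrix (Fin d) (Fin d) ℝ} (hA : IsUnit A)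
    {h : Matrix (Fin d) (Fin d) ℝ → Matrix (Fin d) (Fin d) ℝ}
    (hh : DifferentiableOn ℝ h {S | S.PosDef})
    (hint : Integrable (fun z => steinOp D (A * Aᵀ) h (gram A z)) (stdGauss (Fin D × Fin d)))
    (hint1 : Integrable (fun z => ‖h (gram A z)‖) (stdGauss (Fin D × Fin d)))
    (hint2 : Integrable (fun z => ‖(gram A z)⁻¹‖ * ‖h (gram A z)‖) (stdGauss (Fin D × Fin d))) :
    ∫ z, steinOp D (A * Aᵀ) h (gram A z) ∂stdGauss (Fin D × Fin d) = 0 := by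
  obtain ⟨C, hC0, hC⟩ := exists_deriv_smoothTransition_le
  have hε : ∀ n : ℕ, (0 : ℝ) < 1 / ((n : ℝ) + 1) := fun n => by positivity
  have hε1 : ∀ n : ℕ, 1 / ((n : ℝ) + 1) ≤ 1 := fun n => by
    rw [div_le_one (by positivity)]
    linarith [(Nat.cast_nonneg n : (0 : ℝ) ≤ n)]
  have hm : ∀ n : ℕ, Integrable (fun z => cutoff (1 / ((n : ℝ) + 1)) (gram A z) *
      steinOp D (A * Aᵀ) h (gram A z)) (stdGauss (Fin D × Fin d)) := fun n => by
    refine hint.mono (((continuous_cutoff _).comp (continuous_gram A)).aestronglyMeasurable.mul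
      hint.aestronglyMeasurable) (Eventually.of_forall fun z => ?_)
    rw [norm_mul, Real.norm_of_nonneg (cutoff_nonneg _ _)]
    exact mul_le_of_le_one_left (norm_nonneg _) (cutoff_le_one _ _)
  have hmeas : ∀ n : ℕ, AEStronglyMeasurable (fun z => cutoff (1 / ((n : ℝ) + 1)) (gram A z) *
      steinOp D (A * Aᵀ) h (gram A z) + (cutoffDetSlope (1 / ((n : ℝ) + 1)) (gram A z) *
        ((gram A z)⁻¹ * h (gram A z)).trace - cutoffTraceSlope (1 / ((n : ℝ) + 1)) (gram A z) *
          (h (gram A z)).trace)) (stdGauss (Fin D × Fin d)) := fun n => by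
    refine (hm n).aestronglyMeasurable.add (AEStronglyMeasurable.sub ?_ ?_)
    · exact ((continuous_cutoffDetSlope _).comp (continuous_gram A)).aestronglyMeasurable.mul
        (aestronglyMeasurable_comp_gram hdD hA (continuousOn_trace_inv_mul hh.continuousOn))
    · exact ((continuous_cutoffTraceSlope _).comp (continuous_gram A)).aestronglyMeasurable.mul
        (aestronglyMeasurable_comp_gram hdD hA (continuousOn_trace hh.continuousOn))
  -- The dominating function is independent of n because the determinant slope is at most 2C and the
  -- trace slope at most εC ≤ C; both slopes are eventually zero at each positive definite matrix.
  have key := tendsto_integral_of_dominated_convergence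
    (fun z => ‖steinOp D (A * Aᵀ) h (gram A z)‖ + (2 * C * (‖(gram A z)⁻¹‖ * ‖h (gram A z)‖) +
      C * (‖(1 : Matrix (Fin d) (Fin d) ℝ)‖ * ‖h (gram A z)‖)))
    hmeas (hint.norm.add ((hint2.const_mul _).add ((hint1.const_mul _).const_mul _)))
    (fun n => by
      filter_upwards [ae_posDef_gram hdD hA] with z hz
      refine (norm_add_le _ _).trans (add_le_add ?_ ((norm_sub_le _ _).trans (add_le_add ?_ ?_)))
      · rw [norm_mul]
        refine mul_le_of_le_one_left (norm_nonneg _) ?_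
        rw [Real.norm_of_nonneg (cutoff_nonneg _ _)]
        exact cutoff_le_one _ _
      · rw [norm_mul, Real.norm_of_nonneg (cutoffDetSlope_nonneg (hε n) hz.det_pos.le)]
        exact mul_le_mul (cutoffDetSlope_le (hε n) hz.det_pos.le hC0 hC) (abs_trace_mul_le _ _)
          (norm_nonneg _) (by positivity)
      · rw [norm_mul, Real.norm_of_nonneg (cutoffTraceSlope_nonneg (hε n))]
        refine mul_le_mul ((cutoffTraceSlope_le (hε n) hC).trans (mul_le_of_le_one_left hC0 (hε1 n)))
          ?_ (norm_nonneg _) hC0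
        have := abs_trace_mul_le 1 (h (gram A z))
        rwa [Matrix.one_mul] at this)
    (f := fun z => steinOp D (A * Aᵀ) h (gram A z)) (by
      filter_upwards [ae_posDef_gram hdD hA] with z hz
      refine tendsto_const_nhds.congr' ?_
      filter_upwards [eventually_cutoff_eq hz] with n hn
      rw [hn.1, hn.2.1, hn.2.2]
      ring)
  refine tendsto_nhds_unique key (tendsto_const_nhds.congr fun n => ?_)
  exact (integral_steinOp_cutoff_eq_zero hd hdD hA hh (hε n) (hm n)).symm

/-- Integrability of `P` is a conclusion, which is how inverse moments are shown finite. In the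
cut-off identity the determinant term has a favourable sign and is dropped, the trace term is O(ε),
and Fatou's lemma passes to the limit. -/
theorem integrable_and_integral_le_of_steinOp (hd : 0 < d) (hdD : d ≤ D)
    {A : Matrix (Fin d) (Fin d) ℝ} (hA : IsUnit A)
    {h : Matrix (Fin d) (Fin d) ℝ → Matrix (Fin d) (Fin d) ℝ}
    (hh : DifferentiableOn ℝ h {S | S.PosDef}) {P N : Matrix (Fin d) (Fin d) ℝ → ℝ}
    (hP : ContinuousOn P {S | S.PosDef}) (hN : ContinuousOn N {S | S.PosDef})
    (hPN : ∀ S, S.PosDef → 2 * steinOp D (A * Aᵀ) h S = P S - N S)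
    (hP0 : ∀ S, S.PosDef → 0 ≤ P S) (hN0 : ∀ S, S.PosDef → 0 ≤ N S)
    (h1 : ∀ S, S.PosDef → 0 ≤ (S⁻¹ * h S).trace) (h2 : ∀ S, S.PosDef → 0 ≤ (h S).trace)
    (hNi : Integrable (fun z => N (gram A z)) (stdGauss (Fin D × Fin d)))
    (hhi : Integrable (fun z => (h (gram A z)).trace) (stdGauss (Fin D × Fin d))) :
    Integrable (fun z => P (gram A z)) (stdGauss (Fin D × Fin d)) ∧
      ∫ z, P (gram A z) ∂stdGauss (Fin D × Fin d) ≤ ∫ z, N (gram A z) ∂stdGauss (Fin D × Fin d) := by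
  obtain ⟨C, hC0, hC⟩ := exists_deriv_smoothTransition_le
  set γ := stdGauss (Fin D × Fin d)
  have hpos := ae_posDef_gram hdD hA
  have hle : ∀ ε : ℝ, 0 < ε → ∫ z, cutoff ε (gram A z) * P (gram A z) ∂γ ≤
      ∫ z, N (gram A z) ∂γ + ε * (2 * C * ∫ z, (h (gram A z)).trace ∂γ) := fun ε hε => by
    have hIP := integrable_mul_comp_gram hdD hA hP (continuous_cutoff ε) hε
      fun S => cutoff_support hε
    have hIN := integrable_mul_comp_gram hdD hA hN (continuous_cutoff ε) hε
      fun S => cutoff_support hε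
    have hI1 := integrable_mul_comp_gram hdD hA (continuousOn_trace_inv_mul hh.continuousOn)
      (continuous_cutoffDetSlope ε) hε fun S => cutoffDetSlope_support hε
    have hI2 := integrable_mul_comp_gram hdD hA (continuousOn_trace hh.continuousOn)
      (continuous_cutoffTraceSlope ε) hε fun S => cutoffTraceSlope_support hε
    have heq : (fun z => cutoff ε (gram A z) * steinOp D (A * Aᵀ) h (gram A z)) =ᵐ[γ]
        fun z => 1 / 2 * (cutoff ε (gram A z) * P (gram A z) -
          cutoff ε (gram A z) * N (gram A z)) := by
      filter_upwards [hpos] with z hz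
      rw [← mul_sub, ← hPN _ hz]
      ring
    have hI0 := ((hIP.sub hIN).const_mul (1 / 2)).congr heq.symm
    have key := integral_steinOp_cutoff_eq_zero hd hdD hA hh hε hI0
    have hadd := integral_add hI0 (hI1.sub hI2)
    simp only [Pi.sub_apply] at hadd
    rw [hadd, integral_congr_ae heq, integral_const_mul, integral_sub hIP hIN,
      integral_sub hI1 hI2] at key
    have e1 : 0 ≤ ∫ z, cutoffDetSlope ε (gram A z) * ((gram A z)⁻¹ * h (gram A z)).trace ∂γ := by
      refine integral_nonneg_of_ae ?_
      filter_upwards [hpos] with z hz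
      exact mul_nonneg (cutoffDetSlope_nonneg hε hz.det_pos.le) (h1 _ hz)
    have e2 : ∫ z, cutoffTraceSlope ε (gram A z) * (h (gram A z)).trace ∂γ ≤
        ε * C * ∫ z, (h (gram A z)).trace ∂γ := by
      rw [← integral_const_mul]
      refine integral_mono_ae hI2 (hhi.const_mul _) ?_
      filter_upwards [hpos] with z hz
      exact mul_le_mul_of_nonneg_right (cutoffTraceSlope_le hε hC) (h2 _ hz)
    have e3 : ∫ z, cutoff ε (gram A z) * N (gram A z) ∂γ ≤ ∫ z, N (gram A z) ∂γ := by
      refine integral_mono_ae hIN hNi ?_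
      filter_upwards [hpos] with z hz
      exact mul_le_of_le_one_left (hN0 _ hz) (cutoff_le_one _ _)
    linarith
  have hPm := aestronglyMeasurable_comp_gram hdD hA hP
  have hPnn : 0 ≤ᵐ[γ] fun z => P (gram A z) := by
    filter_upwards [hpos] with z hz using hP0 _ hz
  have hfatou : ∫⁻ z, ENNReal.ofReal (P (gram A z)) ∂γ ≤
      ENNReal.ofReal (∫ z, N (gram A z) ∂γ) := by
    calc ∫⁻ z, ENNReal.ofReal (P (gram A z)) ∂γ
        = ∫⁻ z, liminf (fun n : ℕ => ENNReal.ofReal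
            (cutoff (1 / ((n : ℝ) + 1)) (gram A z) * P (gram A z))) atTop ∂γ := by
          refine lintegral_congr_ae ?_
          filter_upwards [hpos] with z hz
          refine (Tendsto.liminf_eq (tendsto_const_nhds.congr' ?_)).symm
          filter_upwards [eventually_cutoff_eq hz] with n hn
          rw [hn.1, one_mul]
      _ ≤ liminf (fun n : ℕ => ∫⁻ z, ENNReal.ofReal
            (cutoff (1 / ((n : ℝ) + 1)) (gram A z) * P (gram A z)) ∂γ) atTop := by
          refine lintegral_liminf_le' fun n => AEMeasurable.ennreal_ofReal ?_
          exact (((continuous_cutoff _).comp (continuous_gram A)).aestronglyMeasurable.mul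
            hPm).aemeasurable
      _ ≤ liminf (fun n : ℕ => ENNReal.ofReal (∫ z, N (gram A z) ∂γ +
            1 / ((n : ℝ) + 1) * (2 * C * ∫ z, (h (gram A z)).trace ∂γ))) atTop := by
          refine liminf_le_liminf (Eventually.of_forall fun n => ?_)
          have hε : (0 : ℝ) < 1 / ((n : ℝ) + 1) := by positivity
          rw [← ofReal_integral_eq_lintegral_ofReal
            (integrable_mul_comp_gram hdD hA hP (continuous_cutoff _) hε
              fun S => cutoff_support hε)]
          · exact ENNReal.ofReal_le_ofReal (hle _ hε)
          · filter_upwards [hPnn] with z hz using mul_nonneg (cutoff_nonneg _ _) hz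
      _ = ENNReal.ofReal (∫ z, N (gram A z) ∂γ) := by
          refine Tendsto.liminf_eq (ENNReal.tendsto_ofReal ?_)
          have := (tendsto_one_div_add_atTop_nhds_zero_nat (𝕜 := ℝ)).mul_const
            (2 * C * ∫ z, (h (gram A z)).trace ∂γ) |>.const_add (∫ z, N (gram A z) ∂γ)
          rwa [zero_mul, add_zero] at this
  have hPi : Integrable (fun z => P (gram A z)) γ :=
    ⟨hPm, (hasFiniteIntegral_iff_ofReal hPnn).2 (hfatou.trans_lt ENNReal.ofReal_lt_top)⟩
  refine ⟨hPi, ?_⟩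
  rw [← ofReal_integral_eq_lintegral_ofReal hPi hPnn] at hfatou
  refine (ENNReal.ofReal_le_ofReal_iff (integral_nonneg_of_ae ?_)).1 hfatou
  filter_upwards [hpos] with z hz using hN0 _ hz

end Stein

/-! ### Inverse moments when V is a multiple of the identity. -/

section Moments

variable {d D : ℕ}

theorem isUnit_of_posDef_mul_transpose {A : Matrix (Fin d) (Fin d) ℝ} (hA : (A * Aᵀ).PosDef) :
    IsUnit A := by
  rw [Matrix.isUnit_iff_isUnit_det, isUnit_iff_ne_zero]
  have := hA.det_pos.ne'
  rw [Matrix.det_mul] at this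
  exact left_ne_zero_of_mul this

theorem exists_hasFDerivWithinAt_trace_inv :
    ∀ S ∈ {S : Matrix (Fin d) (Fin d) ℝ | S.PosDef},
      ∃ L : Matrix (Fin d) (Fin d) ℝ →L[ℝ] ℝ,
        HasFDerivWithinAt (fun S : Matrix (Fin d) (Fin d) ℝ => (S⁻¹).trace) L {S | S.PosDef} S ∧
          ∀ E, L E = -(S⁻¹ * E * S⁻¹).trace := fun S hS => by
  obtain ⟨L, hL, hLv⟩ := exists_hasFDerivAt_matrix_inv (Matrix.PosDef.isUnit hS)
  refine ⟨_, ((LinearMap.toContinuousLinearMap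
    (Matrix.traceLinearMap (Fin d) ℝ ℝ)).hasFDerivAt.comp S hL).hasFDerivWithinAt, fun E => ?_⟩
  show (L E).trace = _
  rw [hLv, Matrix.trace_neg]

theorem symDiv_const {S : Matrix (Fin d) (Fin d) ℝ} (hS : S.PosDef) (P : Matrix (Fin d) (Fin d) ℝ) :
    symDiv (fun _ => P) S = 0 := by
  rw [symDiv_eq hS (hasFDerivWithinAt_const P S _)]
  refine Finset.sum_eq_zero fun i _ => Finset.sum_eq_zero fun j _ => ?_
  rw [zero_apply, Matrix.zero_apply, mul_zero]

theorem sq_norm_inv_eq_trace {S : Matrix (Fin d) (Fin d) ℝ} (hS : S.PosDef) :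
    ‖S⁻¹‖ ^ 2 = (S⁻¹ * S⁻¹).trace := by
  have : S⁻¹ᵀ = S⁻¹ := hS.inv.isHermitian
  rw [sq_frobenius_norm_eq_trace, this]

/-- The test field whose Stein identity gives the second moment of an inverse Wishart matrix. -/
noncomputable def invField (m : ℝ) (S : Matrix (Fin d) (Fin d) ℝ) : Matrix (Fin d) (Fin d) ℝ :=
  m • S⁻¹ + (S⁻¹).trace • 1

theorem hasFDerivWithinAt_invField (m : ℝ) {S : Matrix (Fin d) (Fin d) ℝ} (hS : S.PosDef) :
    ∃ L : Matrix (Fin d) (Fin d) ℝ →L[ℝ] Matrix (Fin d) (Fin d) ℝ,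
      HasFDerivWithinAt (invField m) L {S | S.PosDef} S ∧
        ∀ E, L E = m • -(S⁻¹ * E * S⁻¹) + (-(S⁻¹ * E * S⁻¹).trace) • 1 := by
  obtain ⟨L, hL, hLv⟩ := exists_hasFDerivAt_matrix_inv hS.isUnit
  obtain ⟨T, hT, hTv⟩ := exists_hasFDerivWithinAt_trace_inv S hS
  refine ⟨m • L + T.smulRight (1 : Matrix (Fin d) (Fin d) ℝ),
    (hL.hasFDerivWithinAt.const_smul m).add
      (hT.smul_const (1 : Matrix (Fin d) (Fin d) ℝ)), fun E => ?_⟩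
  rw [← hLv, ← hTv]
  rfl

theorem symDiv_invField (m : ℝ) {S : Matrix (Fin d) (Fin d) ℝ} (hS : S.PosDef) :
    symDiv (invField m) S =
      -(m / 2 * ((S⁻¹).trace ^ 2 + (S⁻¹ * S⁻¹).trace)) - (S⁻¹ * S⁻¹).trace := by
  obtain ⟨L, hL, hLv⟩ := hasFDerivWithinAt_invField m hS
  rw [symDiv_eq hS hL]
  have hst : ∀ i j, S⁻¹ j i = S⁻¹ i j := fun i j => congrFun (congrFun hS.inv.isHermitian i) j
  have htr : ∀ i j, (S⁻¹ * Matrix.single i j (1 : ℝ) * S⁻¹).trace = (S⁻¹ * S⁻¹) j i := fun i j => by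
    rw [Matrix.trace_mul_comm, ← Matrix.mul_assoc, Matrix.trace_mul_single]
    simp
  have h1 : ∀ i j, 1 / 2 * L (Matrix.single i j 1 + Matrix.single j i 1) i j =
      -(m / 2) * (S⁻¹ i i * S⁻¹ j j) - m / 2 * (S⁻¹ i j * S⁻¹ j i) -
        if i = j then (S⁻¹ * S⁻¹) i i else 0 := fun i j => by
    rw [hLv, Matrix.mul_add, Matrix.add_mul, Matrix.trace_add, htr, htr, Matrix.add_apply,
      Matrix.smul_apply, Matrix.smul_apply, Matrix.neg_apply, Matrix.add_apply,
      mul_single_mul_apply, mul_single_mul_apply, Matrix.one_apply, hst i j]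
    split_ifs with hij
    · subst hij
      simp only [smul_eq_mul]
      ring
    · simp only [smul_eq_mul]
      ring
  simp_rw [h1, Finset.sum_sub_distrib, ← Finset.mul_sum]
  have h2 : ∑ i, ∑ j, S⁻¹ i j * S⁻¹ j i = (S⁻¹ * S⁻¹).trace := by
    simp only [Matrix.trace, Matrix.diag, Matrix.mul_apply]
  have h3 : ∑ i, S⁻¹ i i * ∑ j, S⁻¹ j j = (S⁻¹).trace ^ 2 := by
    rw [← Finset.sum_mul, sq]
    rfl
  have h4 : ∑ i, ∑ j, (if i = j then (S⁻¹ * S⁻¹) i i else 0) = (S⁻¹ * S⁻¹).trace := by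
    simp only [Finset.sum_ite_eq, Finset.mem_univ, if_true]
    rfl
  rw [h2, h3, h4]
  ring

/-- The coefficient m = D − d − 1 in the field is chosen so that the (tr S⁻¹)² terms cancel. What
remains on ‖S⁻¹‖² is m² − m − 2 = (m − 2)(m + 1). -/
theorem steinOp_invField {V : Matrix (Fin d) (Fin d) ℝ} {c : ℝ} (hV : V⁻¹ = c • 1)
    {S : Matrix (Fin d) (Fin d) ℝ} (hS : S.PosDef) :
    2 * steinOp D V (invField ((D : ℝ) - d - 1)) S =
      ((D : ℝ) - d - 3) * ((D : ℝ) - d) * ‖S⁻¹‖ ^ 2 - c * ((D : ℝ) - 1) * (S⁻¹).trace := by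
  rw [steinOp, symDiv_invField _ hS, sq_norm_inv_eq_trace hS, hV, invField]
  simp only [Matrix.add_mul, Matrix.mul_sub, Matrix.smul_mul, Matrix.mul_smul, Matrix.mul_one,
    Matrix.one_mul, Matrix.trace_add, Matrix.trace_sub, Matrix.trace_smul, smul_eq_mul,
    Matrix.trace_one, Fintype.card_fin]
  ring

theorem differentiableOn_invField (m : ℝ) :
    DifferentiableOn ℝ (invField m : Matrix (Fin d) (Fin d) ℝ → _) {S | S.PosDef} := fun _ hS =>
  (hasFDerivWithinAt_invField m hS).choose_spec.1.differentiableWithinAt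

theorem trace_inv_mul_inv_nonneg {S : Matrix (Fin d) (Fin d) ℝ} (hS : S.PosDef) :
    0 ≤ (S⁻¹ * S⁻¹).trace := by
  rw [← sq_norm_inv_eq_trace hS]
  positivity

theorem continuousOn_trace_inv :
    ContinuousOn (fun S : Matrix (Fin d) (Fin d) ℝ => (S⁻¹).trace) {S | S.PosDef} :=
  continuousOn_trace continuousOn_inv

theorem integral_trace_inv_le (hd : 0 < d) (hdD : d ≤ D) {A : Matrix (Fin d) (Fin d) ℝ}
    (hA : IsUnit A) {c : ℝ} (hc : 0 ≤ c) (hV : (A * Aᵀ)⁻¹ = c • 1) (hm : (d : ℝ) + 1 < D) :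
    Integrable (fun z => ((gram A z)⁻¹).trace) (stdGauss (Fin D × Fin d)) ∧
      ((D : ℝ) - d - 1) * ∫ z, ((gram A z)⁻¹).trace ∂stdGauss (Fin D × Fin d) ≤ c * d := by
  have hm' : 0 < (D : ℝ) - d - 1 := by linarith
  have key := integrable_and_integral_le_of_steinOp hd hdD hA
    (h := fun _ => (1 : Matrix (Fin d) (Fin d) ℝ)) (differentiableOn_const _)
    (P := fun S => ((D : ℝ) - d - 1) * (S⁻¹).trace) (N := fun _ => c * d)
    (continuousOn_const.mul continuousOn_trace_inv) continuousOn_const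
    (fun S hS => by
      rw [steinOp, symDiv_const hS, hV]
      simp only [Matrix.one_mul, Matrix.trace_sub, Matrix.trace_smul, smul_eq_mul,
        Matrix.trace_one, Fintype.card_fin]
      ring)
    (fun S hS => mul_nonneg hm'.le hS.inv.posSemidef.trace_nonneg) (fun S hS => by positivity)
    (fun S hS => by
      rw [Matrix.mul_one]
      exact hS.inv.posSemidef.trace_nonneg)
    (fun S hS => by
      rw [Matrix.trace_one]
      positivity)
    (integrable_const _) (integrable_const _)
  refine ⟨?_, ?_⟩
  · have := key.1.const_mul ((D : ℝ) - d - 1)⁻¹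
    simpa only [inv_mul_cancel_left₀ hm'.ne'] using this
  · have := key.2
    rw [integral_const_mul, integral_const, probReal_univ, one_smul] at this
    exact this

theorem integral_sq_norm_inv_le (hd : 0 < d) (hdD : d ≤ D) {A : Matrix (Fin d) (Fin d) ℝ}
    (hA : IsUnit A) {c : ℝ} (hc : 0 ≤ c) (hV : (A * Aᵀ)⁻¹ = c • 1) (hm : (d : ℝ) + 3 < D) :
    Integrable (fun z => ‖(gram A z)⁻¹‖ ^ 2) (stdGauss (Fin D × Fin d)) ∧
      ((D : ℝ) - d - 3) * ((D : ℝ) - d) * ∫ z, ‖(gram A z)⁻¹‖ ^ 2 ∂stdGauss (Fin D × Fin d) ≤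
        c * ((D : ℝ) - 1) * ∫ z, ((gram A z)⁻¹).trace ∂stdGauss (Fin D × Fin d) := by
  have hd1 : (1 : ℝ) ≤ d := by exact_mod_cast hd
  have hmm : 0 < ((D : ℝ) - d - 3) * ((D : ℝ) - d) := mul_pos (by linarith) (by linarith)
  have hm1 : 0 ≤ (D : ℝ) - d - 1 := by linarith
  have ht := (integral_trace_inv_le hd hdD hA hc hV (by linarith)).1
  have htr : ∀ S : Matrix (Fin d) (Fin d) ℝ,
      (invField ((D : ℝ) - d - 1) S).trace = ((D : ℝ) - 1) * (S⁻¹).trace := fun S => by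
    rw [invField, Matrix.trace_add, Matrix.trace_smul, Matrix.trace_smul, Matrix.trace_one,
      smul_eq_mul, smul_eq_mul, Fintype.card_fin]
    ring
  have key := integrable_and_integral_le_of_steinOp hd hdD hA
    (differentiableOn_invField ((D : ℝ) - d - 1))
    (P := fun S => ((D : ℝ) - d - 3) * ((D : ℝ) - d) * ‖S⁻¹‖ ^ 2)
    (N := fun S => c * ((D : ℝ) - 1) * (S⁻¹).trace)
    (continuousOn_const.mul (continuous_norm.comp_continuousOn continuousOn_inv |>.pow 2))
    (continuousOn_const.mul continuousOn_trace_inv)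
    (fun S hS => steinOp_invField hV hS)
    (fun S hS => by positivity)
    (fun S hS => mul_nonneg (mul_nonneg hc (by linarith)) hS.inv.posSemidef.trace_nonneg)
    (fun S hS => by
      rw [invField, Matrix.mul_add, Matrix.mul_smul, Matrix.mul_smul, Matrix.mul_one,
        Matrix.trace_add, Matrix.trace_smul, Matrix.trace_smul, smul_eq_mul, smul_eq_mul]
      exact add_nonneg (mul_nonneg hm1 (trace_inv_mul_inv_nonneg hS)) (mul_self_nonneg _))
    (fun S hS => by
      rw [htr]
      exact mul_nonneg (by linarith) hS.inv.posSemidef.trace_nonneg)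
    (ht.const_mul _) (by
      simp_rw [htr]
      exact ht.const_mul _)
  refine ⟨?_, ?_⟩
  · have := key.1.const_mul (((D : ℝ) - d - 3) * ((D : ℝ) - d))⁻¹
    simpa only [inv_mul_cancel_left₀ hmm.ne'] using this
  · have := key.2
    rw [integral_const_mul, integral_const_mul] at this
    exact this

theorem lintegral_sq_norm_score_le (hd : 5 ≤ d) {A : Matrix (Fin d) (Fin d) ℝ} (hA : IsUnit A)
    (hV : (A * Aᵀ)⁻¹ = (2 * d : ℝ) • 1) :
    ∫⁻ z, ENNReal.ofReal (‖((d : ℝ) - 1) • (gram A z)⁻¹ - (A * Aᵀ)⁻¹‖ ^ 2)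
      ∂stdGauss (Fin (2 * d) × Fin d) ≤ ENNReal.ofReal (16 * d ^ 3) := by
  have hd5 : (5 : ℝ) ≤ d := by exact_mod_cast hd
  have hcast : ((2 * d : ℕ) : ℝ) = 2 * d := by push_cast; ring
  have h1 := integral_trace_inv_le (D := 2 * d) (by omega) (by omega) hA (by positivity) hV
    (by rw [hcast]; linarith)
  have h2 := integral_sq_norm_inv_le (D := 2 * d) (by omega) (by omega) hA (by positivity) hV
    (by rw [hcast]; linarith)
  have hsq : ∀ S : Matrix (Fin d) (Fin d) ℝ, S.PosDef →
      ‖((d : ℝ) - 1) • S⁻¹ - (A * Aᵀ)⁻¹‖ ^ 2 =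
        ((d : ℝ) - 1) ^ 2 * ‖S⁻¹‖ ^ 2 - 4 * d * (d - 1) * (S⁻¹).trace + 4 * d ^ 3 := fun S hS => by
    have hst : S⁻¹ᵀ = S⁻¹ := hS.inv.isHermitian
    rw [sq_norm_inv_eq_trace hS, sq_frobenius_norm_eq_trace, hV]
    simp only [Matrix.transpose_sub, Matrix.transpose_smul, Matrix.transpose_one, hst,
      Matrix.sub_mul, Matrix.mul_sub, Matrix.smul_mul, Matrix.mul_smul, Matrix.mul_one,
      Matrix.one_mul, Matrix.trace_sub, Matrix.trace_smul, smul_eq_mul,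
      Matrix.trace_one, Fintype.card_fin]
    ring
  have hpos := ae_posDef_gram (D := 2 * d) (by omega) hA
  have hI := ((h2.1.const_mul (((d : ℝ) - 1) ^ 2)).sub
    (h1.1.const_mul (4 * d * ((d : ℝ) - 1)))).add (integrable_const (4 * (d : ℝ) ^ 3))
  have heq : (fun z => ‖((d : ℝ) - 1) • (gram A z)⁻¹ - (A * Aᵀ)⁻¹‖ ^ 2)
      =ᵐ[stdGauss (Fin (2 * d) × Fin d)] fun z => ((d : ℝ) - 1) ^ 2 * ‖(gram A z)⁻¹‖ ^ 2 -
        4 * d * ((d : ℝ) - 1) * ((gram A z)⁻¹).trace + 4 * (d : ℝ) ^ 3 := by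
    filter_upwards [hpos] with z hz using hsq _ hz
  rw [← ofReal_integral_eq_lintegral_ofReal (hI.congr heq.symm)
    (Eventually.of_forall fun z => sq_nonneg _), integral_congr_ae heq]
  refine ENNReal.ofReal_le_ofReal ?_
  have hadd := integral_add ((h2.1.const_mul (((d : ℝ) - 1) ^ 2)).sub
    (h1.1.const_mul (4 * d * ((d : ℝ) - 1)))) (integrable_const (4 * (d : ℝ) ^ 3))
  have hsub := integral_sub (h2.1.const_mul (((d : ℝ) - 1) ^ 2))
    (h1.1.const_mul (4 * d * ((d : ℝ) - 1)))
  simp only [Pi.sub_apply] at hadd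
  rw [hadd, hsub, integral_const_mul, integral_const_mul, integral_const, probReal_univ, one_smul]
  have e1 := h1.2
  have e2 := h2.2
  rw [hcast] at e1 e2
  set t := ∫ z, ((gram A z)⁻¹).trace ∂stdGauss (Fin (2 * d) × Fin d)
  set a := ∫ z, ‖(gram A z)⁻¹‖ ^ 2 ∂stdGauss (Fin (2 * d) × Fin d)
  set x : ℝ := (d : ℝ)
  have hx0 : 0 < x := by linarith
  have hx3 : 0 < x - 3 := by linarith
  have e3 : (x - 3) * a ≤ 2 * (2 * x - 1) * t := by
    refine le_of_mul_le_mul_left ?_ hx0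
    linarith
  have e4 : (x - 1) * t ≤ 2 * x ^ 2 := by linarith
  -- Only upper bounds on t and a are available, yet t enters with a negative sign. Once a is
  -- replaced by its bound in terms of t, the net coefficient of (x − 1)t is 6x + 2 > 0, so the
  -- upper bound on t suffices.
  refine le_of_mul_le_mul_left ?_ hx3
  calc (x - 3) * ((x - 1) ^ 2 * a - 4 * x * (x - 1) * t + 4 * x ^ 3)
      = (x - 1) ^ 2 * ((x - 3) * a) - 4 * x * (x - 3) * ((x - 1) * t) + 4 * x ^ 3 * (x - 3) := by
        ring
    _ ≤ (x - 1) ^ 2 * (2 * (2 * x - 1) * t) - 4 * x * (x - 3) * ((x - 1) * t) +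
          4 * x ^ 3 * (x - 3) := by gcongr
    _ = (6 * x + 2) * ((x - 1) * t) + 4 * x ^ 3 * (x - 3) := by ring
    _ ≤ (6 * x + 2) * (2 * x ^ 2) + 4 * x ^ 3 * (x - 3) := by gcongr
    -- After division by 4x² this is 3x² − 12x − 1 ≥ 0, which fails at x = 4 and holds from x = 5
    -- on.
    _ ≤ (x - 3) * (16 * x ^ 3) := by nlinarith [mul_pos hx0 hx0, mul_pos hx0 (mul_pos hx0 hx0)]

end Moments

/-! ### Cauchy–Schwarz and the degenerate cases. -/

section Bound

variable {d D : ℕ}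

theorem lintegral_map_gram (hdD : d ≤ D) {A : Matrix (Fin d) (Fin d) ℝ} (hA : IsUnit A)
    {f : Matrix (Fin d) (Fin d) ℝ → ℝ} (hf : ContinuousOn f {S | S.PosDef}) :
    ∫⁻ S, ENNReal.ofReal (f S) ∂(stdGauss (Fin D × Fin d)).map (gram A) =
      ∫⁻ z, ENNReal.ofReal (f (gram A z)) ∂stdGauss (Fin D × Fin d) := by
  have hg : AEMeasurable (gram A) (stdGauss (Fin D × Fin d)) :=
    (continuous_gram A).measurable.aemeasurable
  refine lintegral_map' (AEMeasurable.ennreal_ofReal ?_) hg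
  have hae : ∀ᵐ S ∂(stdGauss (Fin D × Fin d)).map (gram A), S ∈ {S | S.PosDef} :=
    (ae_map_iff hg measurableSet_posDef).2 (ae_posDef_gram hdD hA)
  have := hf.aemeasurable (μ := (stdGauss (Fin D × Fin d)).map (gram A)) measurableSet_posDef
  rwa [Measure.restrict_eq_self_of_ae_mem hae] at this

/-- In the divergence of the identity field each diagonal entry contributes 1 and each off-diagonal
entry 1/2, giving d + d(d−1)/2. -/
theorem symDiv_eq_symDiv_sub_add {g : Matrix (Fin d) (Fin d) ℝ → Matrix (Fin d) (Fin d) ℝ}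
    {S : Matrix (Fin d) (Fin d) ℝ} (hS : S.PosDef)
    (hg : DifferentiableWithinAt ℝ g {A | A.PosDef} S) :
    symDiv g S = symDiv (fun A => g A - A) S + (d : ℝ) * (d + 1) / 2 := by
  have h1 := hg.hasFDerivWithinAt
  set g' := fderivWithin ℝ g {A | A.PosDef} S
  have h2 : HasFDerivWithinAt (fun A => g A - A)
      (g' - ContinuousLinearMap.id ℝ (Matrix (Fin d) (Fin d) ℝ)) {A | A.PosDef} S :=
    h1.sub (hasFDerivWithinAt_id S _)
  have h3 : ∀ i j, (g' - ContinuousLinearMap.id ℝ (Matrix (Fin d) (Fin d) ℝ))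
      (Matrix.single i j 1 + Matrix.single j i 1) i j =
        g' (Matrix.single i j 1 + Matrix.single j i 1) i j - ((1 : ℝ) + if i = j then 1 else 0) :=
    fun i j => by
      show g' (Matrix.single i j 1 + Matrix.single j i 1) i j -
        (Matrix.single i j (1 : ℝ) + Matrix.single j i (1 : ℝ)) i j = _
      rw [Matrix.add_apply, Matrix.single_apply, Matrix.single_apply]
      simp only [and_self]
      by_cases hij : i = j
      · subst hij; simp
      · simp [hij, Ne.symm hij]
  rw [symDiv_eq hS h1, symDiv_eq hS h2]
  simp_rw [h3, mul_sub, Finset.sum_sub_distrib, mul_add, Finset.sum_add_distrib, mul_ite, mul_one,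
    mul_zero, Finset.sum_ite_eq, Finset.mem_univ, if_true, Finset.sum_const, Finset.card_univ,
    Fintype.card_fin, nsmul_eq_mul]
  ring

theorem memLp_two_of_lintegral_sq_norm_ne_top {Ω : Type*} [MeasurableSpace Ω] {μ : Measure Ω}
    {f : Ω → Matrix (Fin d) (Fin d) ℝ} (hf : AEStronglyMeasurable f μ)
    (h : ∫⁻ z, ENNReal.ofReal (‖f z‖ ^ 2) ∂μ ≠ ∞) : MemLp f 2 μ := by
  have h1 : Integrable (fun z => ‖f z‖ ^ 2) μ :=
    ⟨(hf.norm.pow 2), (hasFiniteIntegral_iff_ofReal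
      (Eventually.of_forall fun z => sq_nonneg _)).2 h.lt_top⟩
  exact (memLp_two_iff_integrable_sq_norm hf).2 h1

theorem continuousOn_score (m : ℝ) (W : Matrix (Fin d) (Fin d) ℝ) :
    ContinuousOn (fun S : Matrix (Fin d) (Fin d) ℝ => m • S⁻¹ - W) {S | S.PosDef} :=
  (continuousOn_inv.const_smul m).sub continuousOn_const

theorem aestronglyMeasurable_matrix_comp_gram (hdD : d ≤ D) {A : Matrix (Fin d) (Fin d) ℝ}
    (hA : IsUnit A) {f : Matrix (Fin d) (Fin d) ℝ → Matrix (Fin d) (Fin d) ℝ}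
    (hf : ContinuousOn f {S | S.PosDef}) :
    AEStronglyMeasurable (fun z => f (gram A z)) (stdGauss (Fin D × Fin d)) := by
  have h1 : TopologicalSpace.PseudoMetrizableSpace (Matrix (Fin d) (Fin d) ℝ) :=
    inferInstanceAs (TopologicalSpace.PseudoMetrizableSpace (Fin d → Fin d → ℝ))
  have h2 : SecondCountableTopology (Matrix (Fin d) (Fin d) ℝ) :=
    inferInstanceAs (SecondCountableTopology (Fin d → Fin d → ℝ))
  exact aestronglyMeasurable_comp_gram hdD hA hf

theorem ofReal_neg_integral_symDiv_le (hd : 0 < d) (hdD : d ≤ D) (hD : D ≠ d + 1)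
    {A : Matrix (Fin d) (Fin d) ℝ} (hA : IsUnit A)
    {h : Matrix (Fin d) (Fin d) ℝ → Matrix (Fin d) (Fin d) ℝ}
    (hh : DifferentiableOn ℝ h {S | S.PosDef})
    (hint : Integrable (fun z => symDiv h (gram A z)) (stdGauss (Fin D × Fin d)))
    (hX : ∫⁻ z, ENNReal.ofReal (‖h (gram A z)‖ ^ 2) ∂stdGauss (Fin D × Fin d) ≠ ∞)
    (hY : ∫⁻ z, ENNReal.ofReal (‖((D : ℝ) - d - 1) • (gram A z)⁻¹ - (A * Aᵀ)⁻¹‖ ^ 2)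
      ∂stdGauss (Fin D × Fin d) ≠ ∞) :
    ENNReal.ofReal (-∫ z, symDiv h (gram A z) ∂stdGauss (Fin D × Fin d)) ≤
      1 / 2 * (∫⁻ z, ENNReal.ofReal (‖h (gram A z)‖ ^ 2) ∂stdGauss (Fin D × Fin d)) ^ (1 / 2 : ℝ) *
        (∫⁻ z, ENNReal.ofReal (‖((D : ℝ) - d - 1) • (gram A z)⁻¹ - (A * Aᵀ)⁻¹‖ ^ 2)
          ∂stdGauss (Fin D × Fin d)) ^ (1 / 2 : ℝ) := by
  set γ := stdGauss (Fin D × Fin d)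
  have hm : (D : ℝ) - d - 1 ≠ 0 := fun h0 => hD (by
    have : (D : ℝ) = d + 1 := by linarith
    exact_mod_cast this)
  set U : Matrix (Fin d) (Fin d) ℝ → Matrix (Fin d) (Fin d) ℝ :=
    fun S => ((D : ℝ) - d - 1) • S⁻¹ - (A * Aᵀ)⁻¹ with hU
  have hhm := aestronglyMeasurable_matrix_comp_gram hdD hA hh.continuousOn
  have hUm := aestronglyMeasurable_matrix_comp_gram hdD hA
    (continuousOn_score ((D : ℝ) - d - 1) (A * Aᵀ)⁻¹)
  have hhL : MemLp (fun z => h (gram A z)) 2 γ := memLp_two_of_lintegral_sq_norm_ne_top hhm hX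
  have hUL : MemLp (fun z => U (gram A z)) 2 γ := memLp_two_of_lintegral_sq_norm_ne_top hUm hY
  have hhn : Integrable (fun z => ‖h (gram A z)‖) γ :=
    MemLp.integrable one_le_two hhL.norm
  -- As D ≠ d + 1, Σ⁻¹ can be recovered from the square-integrable score U, so no separate moment
  -- assumption on Σ⁻¹ is needed; it may fail to hold for D close to d.
  have hSL : Integrable (fun z => ‖(gram A z)⁻¹‖ * ‖h (gram A z)‖) γ := by
    refine (((hUL.norm.integrable_mul hhL.norm).add (hhn.const_mul
      ‖(A * Aᵀ)⁻¹‖)).const_mul |(D : ℝ) - d - 1|⁻¹).mono'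
        ((aestronglyMeasurable_comp_gram hdD hA (continuous_norm.comp_continuousOn
          continuousOn_inv)).mul hhm.norm) (Eventually.of_forall fun z => ?_)
    have h1 : ‖(gram A z)⁻¹‖ ≤ |(D : ℝ) - d - 1|⁻¹ * (‖U (gram A z)‖ + ‖(A * Aᵀ)⁻¹‖) := by
      rw [le_inv_mul_iff₀ (abs_pos.2 hm), ← Real.norm_eq_abs, ← norm_smul]
      calc _ = ‖U (gram A z) + (A * Aᵀ)⁻¹‖ := by rw [hU, sub_add_cancel]
        _ ≤ _ := norm_add_le _ _
    rw [norm_mul, norm_norm, norm_norm]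
    refine (mul_le_mul_of_nonneg_right h1 (norm_nonneg _)).trans_eq ?_
    simp only [Pi.add_apply, Pi.mul_apply]
    ring
  have hhU : Integrable (fun z => ‖h (gram A z)‖ * ‖U (gram A z)‖) γ :=
    hhL.norm.integrable_mul hUL.norm
  have htr : Integrable (fun z => (h (gram A z) * U (gram A z)).trace) γ := by
    refine hhU.mono' (aestronglyMeasurable_comp_gram hdD hA (continuousOn_trace
      (hh.continuousOn.mul (continuousOn_score ((D : ℝ) - d - 1) (A * Aᵀ)⁻¹)))) ?_
    exact Eventually.of_forall fun z => abs_trace_mul_le _ _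
  have hstein := integral_steinOp_eq_zero hd hdD hA hh (hint.add (htr.const_mul (1 / 2)))
    hhn hSL
  have hadd := integral_add hint (htr.const_mul (1 / 2))
  have hstein' : ∫ z, (symDiv h (gram A z) + 1 / 2 * (h (gram A z) * U (gram A z)).trace) ∂γ = 0 :=
    hstein
  rw [hadd, integral_const_mul] at hstein'
  have h1 : -∫ z, symDiv h (gram A z) ∂γ ≤ 1 / 2 * ∫ z, ‖h (gram A z)‖ * ‖U (gram A z)‖ ∂γ := by
    have := integral_mono htr hhU fun z => (le_abs_self _).trans (abs_trace_mul_le _ _)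
    linarith
  refine (ENNReal.ofReal_le_ofReal h1).trans ?_
  rw [ENNReal.ofReal_mul (by norm_num), ofReal_integral_eq_lintegral_ofReal hhU
    (Eventually.of_forall fun z => by positivity), mul_assoc]
  have hhalf : ENNReal.ofReal (1 / 2) = 1 / 2 := by
    rw [ENNReal.ofReal_div_of_pos two_pos]
    simp
  rw [hhalf]
  gcongr
  have hcs := ENNReal.lintegral_mul_le_Lp_mul_Lq γ Real.HolderConjugate.two_two
    (f := fun z => ENNReal.ofReal ‖h (gram A z)‖) (g := fun z => ENNReal.ofReal ‖U (gram A z)‖)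
    hhm.norm.aemeasurable.ennreal_ofReal hUm.norm.aemeasurable.ennreal_ofReal
  have hsq : ∀ x : Matrix (Fin d) (Fin d) ℝ,
      ENNReal.ofReal ‖x‖ ^ (2 : ℝ) = ENNReal.ofReal (‖x‖ ^ 2) := fun x => by
    rw [ENNReal.ofReal_pow (norm_nonneg _), ← ENNReal.rpow_natCast]
    norm_num
  simp only [hsq, Pi.mul_apply, ← ENNReal.ofReal_mul (norm_nonneg _)] at hcs
  exact hcs

theorem ofReal_sub_integral_symDiv_le (hdD : d ≤ D) (hD : D ≠ d + 1)
    {A : Matrix (Fin d) (Fin d) ℝ} (hA : IsUnit A)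
    {g : Matrix (Fin d) (Fin d) ℝ → Matrix (Fin d) (Fin d) ℝ}
    (hg : DifferentiableOn ℝ g {S | S.PosDef})
    (hint : Integrable (fun z => symDiv g (gram A z)) (stdGauss (Fin D × Fin d))) :
    ENNReal.ofReal ((d : ℝ) * (d + 1) / 2 -
        ∫ z, symDiv g (gram A z) ∂stdGauss (Fin D × Fin d)) ≤
      1 / 2 * (∫⁻ z, ENNReal.ofReal (‖gram A z - g (gram A z)‖ ^ 2)
          ∂stdGauss (Fin D × Fin d)) ^ (1 / 2 : ℝ) *
        (∫⁻ z, ENNReal.ofReal (‖((D : ℝ) - d - 1) • (gram A z)⁻¹ - (A * Aᵀ)⁻¹‖ ^ 2)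
          ∂stdGauss (Fin D × Fin d)) ^ (1 / 2 : ℝ) := by
  rcases Nat.eq_zero_or_pos d with rfl | hd
  · simp [symDiv]
  set γ := stdGauss (Fin D × Fin d)
  have hpos := ae_posDef_gram hdD hA
  have hh : DifferentiableOn ℝ (fun S => g S - S) {S | S.PosDef} := hg.sub differentiableOn_id
  have heq : (fun z => symDiv g (gram A z)) =ᵐ[γ]
      fun z => symDiv (fun S => g S - S) (gram A z) + (d : ℝ) * (d + 1) / 2 := by
    filter_upwards [hpos] with z hz using symDiv_eq_symDiv_sub_add hz (hg _ hz)
  have hhi : Integrable (fun z => symDiv (fun S => g S - S) (gram A z)) γ :=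
    ((hint.congr heq).sub (integrable_const ((d : ℝ) * (d + 1) / 2))).congr
      (Eventually.of_forall fun z => add_sub_cancel_right _ _)
  have hI : (d : ℝ) * (d + 1) / 2 - ∫ z, symDiv g (gram A z) ∂γ =
      -∫ z, symDiv (fun S => g S - S) (gram A z) ∂γ := by
    rw [integral_congr_ae heq, integral_add hhi (integrable_const _), integral_const,
      probReal_univ, one_smul]
    ring
  rw [hI]
  simp_rw [norm_sub_rev (gram A _) (g _)]
  set X := ∫⁻ z, ENNReal.ofReal (‖g (gram A z) - gram A z‖ ^ 2) ∂γ with hX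
  set Y := ∫⁻ z, ENNReal.ofReal (‖((D : ℝ) - d - 1) • (gram A z)⁻¹ - (A * Aᵀ)⁻¹‖ ^ 2) ∂γ with hY
  have hae : ∀ f : Matrix (Fin d) (Fin d) ℝ → Matrix (Fin d) (Fin d) ℝ,
      ContinuousOn f {S | S.PosDef} → ∫⁻ z, ENNReal.ofReal (‖f (gram A z)‖ ^ 2) ∂γ = 0 →
        ∀ S, S.PosDef → f S = 0 := fun f hf h0 => by
    refine eqOn_posDef_of_ae_eq hdD hA hf continuousOn_const ?_
    have hm : AEMeasurable (fun z => ENNReal.ofReal (‖f (gram A z)‖ ^ 2)) γ :=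
      ((aestronglyMeasurable_matrix_comp_gram hdD hA hf).norm.pow 2).aemeasurable.ennreal_ofReal
    filter_upwards [(lintegral_eq_zero_iff' hm).1 h0] with z hz
    have hz' : ENNReal.ofReal (‖f (gram A z)‖ ^ 2) = 0 := hz
    rw [ENNReal.ofReal_eq_zero] at hz'
    exact norm_eq_zero.1 (pow_eq_zero_iff two_ne_zero |>.1 (le_antisymm hz' (sq_nonneg _)))
  -- A vanishing score would agree at 1 and at 2·1, forcing D − d − 1 = 0. Hence X = ∞ really makes
  -- the bound infinite.
  have hYne : Y ≠ 0 := fun h0 => by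
    have h1 := hae _ (continuousOn_score ((D : ℝ) - d - 1) (A * Aᵀ)⁻¹) h0
    have hone : (1 : Matrix (Fin d) (Fin d) ℝ).PosDef := Matrix.PosDef.one
    have e1 := h1 1 hone
    have e2 := h1 ((2 : ℝ) • 1) (hone.smul two_pos)
    have hinv : ((2 : ℝ) • (1 : Matrix (Fin d) (Fin d) ℝ))⁻¹ = (1 / 2 : ℝ) • 1 :=
      Matrix.inv_eq_right_inv (by
        rw [Matrix.smul_mul, Matrix.one_mul, smul_smul]; norm_num)
    rw [hinv] at e2
    rw [inv_one] at e1
    have e3 := congrFun (congrFun (e1.trans e2.symm) ⟨0, hd⟩) ⟨0, hd⟩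
    simp only [Matrix.sub_apply, Matrix.smul_apply, Matrix.one_apply_eq, smul_eq_mul] at e3
    refine hD ?_
    have : (D : ℝ) = d + 1 := by linarith
    exact_mod_cast this
  -- With 0·∞ = 0 the right side is 0 even if Y = ∞, so the left side must vanish as well: g − id is
  -- zero on the whole cone, not just almost everywhere, hence so is its divergence.
  by_cases hX0 : X = 0
  · have h1 := hae _ hh.continuousOn hX0
    have h2 : (fun z => symDiv (fun S => g S - S) (gram A z)) =ᵐ[γ] fun _ => 0 := by
      filter_upwards [hpos] with z hz
      have h3 : HasFDerivWithinAt (fun S => g S - S)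
          (0 : Matrix (Fin d) (Fin d) ℝ →L[ℝ] Matrix (Fin d) (Fin d) ℝ) {S | S.PosDef}
          (gram A z) :=
        (hasFDerivWithinAt_const 0 (gram A z) _).congr h1 (h1 _ hz)
      rw [symDiv_eq hz h3]
      refine Finset.sum_eq_zero fun i _ => Finset.sum_eq_zero fun j _ => ?_
      rw [zero_apply, Matrix.zero_apply, mul_zero]
    rw [integral_congr_ae h2]
    simp
  by_cases hXt : X = ∞
  · rw [hXt, ENNReal.top_rpow_of_pos (by norm_num), ENNReal.mul_top (by simp), ENNReal.top_mul]
    · exact le_top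
    · rw [Ne, ENNReal.rpow_eq_zero_iff_of_pos (by norm_num)]
      exact hYne
  by_cases hYt : Y = ∞
  · rw [hYt, ENNReal.top_rpow_of_pos (by norm_num), ENNReal.mul_top]
    · exact le_top
    · refine mul_ne_zero (by simp) ?_
      rw [Ne, ENNReal.rpow_eq_zero_iff_of_pos (by norm_num)]
      exact hX0
  exact ofReal_neg_integral_symDiv_le hd hdD hD hA hh hhi hXt hYt

/-- Truncating K − I at zero loses nothing because B ≥ 0, and B = ∞ gives the void bound. -/
theorem ereal_coe_ge_sub {I K : ℝ} {B : ℝ≥0∞} (h : ENNReal.ofReal (K - I) ≤ B) :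
    (I : EReal) ≥ (K : EReal) - (B : EReal) := by
  refine EReal.sub_le_of_le_add ?_
  have h1 : ((ENNReal.ofReal (K - I) : ℝ≥0∞) : EReal) ≤ (B : EReal) := by exact_mod_cast h
  have h2 : ((K - I : ℝ) : EReal) ≤ ((ENNReal.ofReal (K - I) : ℝ≥0∞) : EReal) := by
    rw [EReal.coe_ennreal_ofReal]
    exact_mod_cast le_max_left _ _
  calc (K : EReal) = (I : EReal) + ((K - I : ℝ) : EReal) := by
        rw [← EReal.coe_add, add_sub_cancel]
    _ ≤ (I : EReal) + (B : EReal) := by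
        gcongr
        exact h2.trans h1

end Bound

end WishartDivergence

/-! ### The theorem. -/

open WishartDivergence in
theorem mainTheorem3 (d D : ℕ) (hdD : d ≤ D) (hD : D ≠ d + 1)
    (V : Matrix (Fin d) (Fin d) ℝ) (hV : V.PosDef)
    (g : Matrix (Fin d) (Fin d) ℝ → Matrix (Fin d) (Fin d) ℝ)
    (hg : DifferentiableOn ℝ g {A | A.PosDef})
    (hint : MeasureTheory.Integrable (WishartDivergence.symDiv g)
      (WishartDivergence.wishart d D V)) :
    (((∫ S, WishartDivergence.symDiv g S ∂(WishartDivergence.wishart d D V) : ℝ) : EReal) ≥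
      (((d : ℝ) * (d + 1) / 2 : ℝ) : EReal) -
        (((1 / 2 : ℝ≥0∞) *
          WishartDivergence.expSqFrob (WishartDivergence.wishart d D V)
            (fun S => S - g S) ^ (1 / 2 : ℝ) *
          WishartDivergence.expSqFrob (WishartDivergence.wishart d D V)
            (fun S => ((D : ℝ) - d - 1) • S⁻¹ - V⁻¹) ^ (1 / 2 : ℝ) : ℝ≥0∞) : EReal)) ∧
    (5 ≤ d → D = 2 * d → V = (1 / (D : ℝ)) • (1 : Matrix (Fin d) (Fin d) ℝ) →
      ((∫ S, WishartDivergence.symDiv g S ∂(WishartDivergence.wishart d D V) : ℝ) : EReal) ≥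
        (((d : ℝ) * (d + 1) / 2 : ℝ) : EReal) -
          ((2 * (d : ℝ≥0∞) ^ (3 / 2 : ℝ) *
            WishartDivergence.expSqFrob (WishartDivergence.wishart d D V)
              (fun S => S - g S) ^ (1 / 2 : ℝ) : ℝ≥0∞) : EReal)) := by
  obtain ⟨A, hAV, hμ⟩ := exists_wishart_eq_map D hV.posSemidef
  have hA : IsUnit A := isUnit_of_posDef_mul_transpose (hAV ▸ hV)
  have hgm : AEMeasurable (gram A) (stdGauss (Fin D × Fin d)) :=
    (continuous_gram A).measurable.aemeasurable
  rw [hμ] at hint ⊢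
  have hint' : MeasureTheory.Integrable (fun z => symDiv g (gram A z)) (stdGauss (Fin D × Fin d)) :=
    (MeasureTheory.integrable_map_measure hint.aestronglyMeasurable hgm).1 hint
  have hX : expSqFrob ((stdGauss (Fin D × Fin d)).map (gram A)) (fun S => S - g S) =
      ∫⁻ z, ENNReal.ofReal (‖gram A z - g (gram A z)‖ ^ 2) ∂stdGauss (Fin D × Fin d) :=
    lintegral_map_gram hdD hA
      ((continuous_norm.comp_continuousOn (continuousOn_id.sub hg.continuousOn)).pow 2)
  have hY : expSqFrob ((stdGauss (Fin D × Fin d)).map (gram A))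
      (fun S => ((D : ℝ) - d - 1) • S⁻¹ - V⁻¹) =
      ∫⁻ z, ENNReal.ofReal (‖((D : ℝ) - d - 1) • (gram A z)⁻¹ - (A * Aᵀ)⁻¹‖ ^ 2)
        ∂stdGauss (Fin D × Fin d) := by
    rw [← hAV]
    exact lintegral_map_gram hdD hA
      ((continuous_norm.comp_continuousOn (continuousOn_score _ _)).pow 2)
  have key := ofReal_sub_integral_symDiv_le hdD hD hA hg hint'
  rw [MeasureTheory.integral_map hgm hint.aestronglyMeasurable, hX, hY]
  refine ⟨ereal_coe_ge_sub key, fun hd5 hD2 hV1 => ereal_coe_ge_sub (key.trans ?_)⟩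
  subst hD2
  have hd0 : (0 : ℝ) < 2 * d := by
    have : (0 : ℝ) < d := by exact_mod_cast (by omega : 0 < d)
    positivity
  have hVi : (A * Aᵀ)⁻¹ = (2 * d : ℝ) • 1 := by
    rw [hAV, hV1]
    refine Matrix.inv_eq_right_inv ?_
    rw [Matrix.smul_mul, Matrix.one_mul, smul_smul]
    push_cast
    rw [one_div, inv_mul_cancel₀ hd0.ne', one_smul]
  have hY2 := lintegral_sq_norm_score_le hd5 hA hVi
  have hcast : (((2 * d : ℕ) : ℝ) - d - 1) = (d : ℝ) - 1 := by push_cast; ring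
  rw [hcast]
  -- The square root of 16d³, times the factor 1/2 of the general bound, gives the constant
  -- 2d^{3/2}.
  have h16 : ENNReal.ofReal (16 * (d : ℝ) ^ 3) ^ (1 / 2 : ℝ) = 4 * (d : ℝ≥0∞) ^ (3 / 2 : ℝ) := by
    rw [ENNReal.ofReal_mul (by norm_num), ENNReal.mul_rpow_of_nonneg _ _ (by norm_num),
      ENNReal.ofReal_pow (by positivity), ENNReal.ofReal_natCast, ← ENNReal.rpow_natCast,
      ← ENNReal.rpow_mul]
    congr 1
    · rw [show (16 : ℝ) = 4 ^ (2 : ℝ) by norm_num, ENNReal.ofReal_rpow_of_pos (by positivity),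
        ← Real.rpow_mul (by norm_num)]
      norm_num
    · norm_num
  refine (mul_le_mul_right (ENNReal.rpow_le_rpow hY2 (by norm_num : (0 : ℝ) ≤ 1 / 2)) _).trans ?_
  rw [h16]
  refine le_of_eq ?_
  have h24 : (1 / 2 : ℝ≥0∞) * 4 = 2 := by
    rw [one_div, show (4 : ℝ≥0∞) = 2 * 2 by norm_num, ← mul_assoc,
      ENNReal.inv_mul_cancel two_ne_zero ENNReal.ofNat_ne_top, one_mul]
  rw [mul_right_comm, ← mul_assoc, h24]
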